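/- **Theorem.** For $\tau$ in the complex upper half-plane $\mathbb{H}$ put $q^x=e^{2\pi i x\tau}$ ($x\in\mathbb{Q}$), let $D=\frac{1}{2\pi i}\frac{d}{d\tau}$, and let $E_k=1+\cdots$ be the normalized Eisenstein series of weight $k$ on $\mathrm{SL}_2(\mathbb{Z})$. For $s\in\mathbb{C}$ consider the modular linear differential equation $$ D^4(f)-E_2D^3(f)+\bigl(3D(E_2)+\alpha_1(s)E_4\bigr)D^2(f)-\Bigl(D^2(E_2)+\tfrac{\alpha_1(s)}{2}D(E_4)-\alpha_2(s)E_6\Bigr)D(f)+\alpha_3(s)E_8f=0, \tag{$\flat_s$} $$ for holomorphic functions $f:\mathbb{H}\to\mathbb{C}$, where $$ \alpha_1(s)=\frac{-25s^2+120s+1332}{7200},\qquad \alpha_2(s)=\frac{(5s+6)^2}{14400},\qquad \alpha_3(s)=\frac{(s-18)(s+6)(5s+6)^2}{8294400}. $$ A function $f$ on $\mathbb{H}$ is *of CFT type* if $f(\tau)=q^{\alpha}\bigl(1+\sum_{n=1}^{\infty}a_nq^n\bigr)$ with $\alpha$ a rational number and every $a_n$ a non-negative integer. It is a *quasimodular form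 of positive depth* if there are a congruence subgroup $\Gamma\subset\mathrm{SL}_2(\mathbb{Z})$, an integer $k$ and an integer $r\ge 1$ such that $f=\sum_{i=0}^{r}A_iE_2^{\,i}$, where $A_i$ is a modular form of weight $k-2i$ on $\Gamma$ (holomorphic on $\mathbb{H}$, meromorphic at the cusps) and $A_r\neq 0$. Let $s$ be a complex number and suppose that $(\flat_s)$ has a solution $f$ of CFT type. Suppose that $f$ is not a quasimodular form of positive depth. Then $s$ is one of the following $17$ numbers: $$ -\tfrac{48}{5},-\tfrac{38}{5},-\tfrac{6}{5},-\tfrac{3}{5},\tfrac{2}{5},\tfrac{6}{5},\tfrac{12}{5},\tfrac{18}{5},\tfrac{22}{5},\tfrac{27}{5},6,\tfrac{32}{5},\tfrac{54}{5},18,-\tfrac{66}{5},-6,-\tfrac{8}{5}. $$ -/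

import Mathlib

open UpperHalfPlane
open scoped MatrixGroups ModularForm Manifold

noncomputable section

namespace MLDE

/-- The operator `D = (2πi)⁻¹ d/dτ = q d/dq` on functions on the upper half-plane. -/
abbrev qD (f : ℍ → ℂ) : ℍ → ℂ := Derivative.normalizedDerivOfComplex f

/-- The normalized Eisenstein series `E₂ = 1 - 24 q - ⋯`. -/
abbrev eis2 : ℍ → ℂ := EisensteinSeries.E2

/-- The normalized Eisenstein series `E₄ = 1 + 240 q + ⋯`. -/
abbrev eis4 : ℍ → ℂ := ⇑(ModularForm.E (k := 4) (by norm_num))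

/-- The normalized Eisenstein series `E₆ = 1 - 504 q - ⋯`. -/
abbrev eis6 : ℍ → ℂ := ⇑(ModularForm.E (k := 6) (by norm_num))

/-- The normalized Eisenstein series `E₈ = 1 + 480 q + ⋯`. -/
abbrev eis8 : ℍ → ℂ := ⇑(ModularForm.E (k := 8) (by norm_num))

def coeff1 (s : ℂ) : ℂ := (-25 * s ^ 2 + 120 * s + 1332) / 7200

def coeff2 (s : ℂ) : ℂ := (5 * s + 6) ^ 2 / 14400

def coeff3 (s : ℂ) : ℂ := (s - 18) * (s + 6) * (5 * s + 6) ^ 2 / 8294400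

/-- `f` is a (holomorphic) solution on the upper half-plane of the fourth order modular linear
differential equation with parameter `s`. -/
def IsSolution (s : ℂ) (f : ℍ → ℂ) : Prop :=
  MDiff f ∧ ∀ τ : ℍ,
    (qD^[4] f) τ - eis2 τ * (qD^[3] f) τ
      + (3 * qD eis2 τ + coeff1 s * eis4 τ) * (qD^[2] f) τ
      - ((qD^[2] eis2) τ + coeff1 s / 2 * qD eis4 τ - coeff2 s * eis6 τ) * qD f τ
      + coeff3 s * eis8 τ * f τ = 0

/-- `f` is of CFT type: `f(τ) = q^α (1 + ∑_{n ≥ 1} aₙ qⁿ)` for `τ` in the upper half-plane, where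
`q^x = exp (2πixτ)`, `α` is rational and all `aₙ` are non-negative integers. -/
def IsCFTType (f : ℍ → ℂ) : Prop :=
  ∃ (α : ℚ) (a : ℕ → ℕ), a 0 = 1 ∧ ∀ τ : ℍ,
    HasSum (fun n : ℕ =>
      (a n : ℂ) * Complex.exp (2 * Real.pi * Complex.I * ((α : ℂ) + (n : ℂ)) * (τ : ℂ))) (f τ)

/-- Modular forms of weight `k` on `Γ`, holomorphic on the upper half-plane and meromorphic
at the cusps (each `f ∣[k] γ` is of at most exponential growth in `Im τ`, i.e. has a Laurent
expansion in a root of `q` with finitely many negative exponents when `Γ` is a congruence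
subgroup). -/
structure IsWeaklyHolomorphicModularForm (Γ : Subgroup SL(2, ℤ)) (k : ℤ) (f : ℍ → ℂ) : Prop where
  holo : MDiff f
  slash_eq : ∀ γ ∈ Γ, f ∣[k] γ = f
  meromorphic_cusps : ∀ γ : SL(2, ℤ), ∃ C : ℝ,
    (f ∣[k] γ) =O[atImInfty] fun τ : ℍ => Real.exp (C * τ.im)

/-- `f` is a quasimodular form of weight `k` and depth `r` on `Γ`: a polynomial in `E₂` of degree
exactly `r` whose `i`-th coefficient is a modular form of weight `k - 2 i` on `Γ` (holomorphic on
the upper half-plane, meromorphic at the cusps). -/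
def IsQuasimodularForm (Γ : Subgroup SL(2, ℤ)) (k : ℤ) (r : ℕ) (f : ℍ → ℂ) : Prop :=
  ∃ A : ℕ → ℍ → ℂ,
    (∀ i ≤ r, IsWeaklyHolomorphicModularForm Γ (k - 2 * (i : ℤ)) (A i)) ∧
    A r ≠ 0 ∧
    ∀ τ : ℍ, f τ = ∑ i ∈ Finset.range (r + 1), A i τ * eis2 τ ^ i

/-- `f` is a quasimodular form of positive depth, of some weight, on some congruence subgroup. -/
def IsQuasimodularOfPositiveDepth (f : ℍ → ℂ) : Prop :=
  ∃ (Γ : Subgroup SL(2, ℤ)) (k : ℤ) (r : ℕ),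
    CongruenceSubgroup.IsCongruenceSubgroup Γ ∧ 0 < r ∧ IsQuasimodularForm Γ k r f

end MLDE

end

/-! Insert `f = q^α ∑ aₙ qⁿ` into the equation. The `aₙ` satisfy a recurrence whose diagonal term is
the indicial polynomial, and this polynomial splits into the linear factors with roots `(s+6)/24`,
`(18-s)/24`, `(5s+6)/120`, `-(5s+6)/120` (`opCoeff_zero`). Hence `α` is one of these roots, and `s`
is rational. The relation for `n = 1` then ties `a₁` to `s`. In each of the four branches one can
cancel a factor that vanishes only at a value of `s` belonging to the list, and what remains has the
form `y (b - y) = N`, with `y` affine in `s`, `b` a positive integer affine in `a₁`, and `N` one of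
4200, 100800, 180, 2880. A rational `y` of this kind is a positive divisor of `N`
(`exists_dvd_of_quadratic`), so only finitely many pairs `(s, α)` remain. Running the recurrence in
exact arithmetic eliminates every pair for which some coefficient is forced to be non-integral or
negative, or for which the recurrence is inconsistent. What survives is the 17 listed values of `s`
and six further pairs (`isListed_of_isSolution`).

For the six pairs the solution has to be shown quasimodular of depth one. Let `u` solve the second
order equation with exponents `2/5`, `3/5`, which is modular in weight 5, and let `w` be its Serre
derivative, of weight 7. (The quotients `u / η¹⁰` satisfy the equation of the Rogers–Ramanujan
functions.) The solution space is a two-dimensional representation of `SL₂(ℤ)`. The relations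
between `S` and `T` determine it as the odd part of the Weil representation of `SL₂(𝔽₅)`, so `Γ(5)`
acts trivially (`exists_basis_slash`). Since `η¹²` has a sign character of level 2, combinations
`A`, `B` of `u`, `w` over `ℤ[E₄, E₆]`, divided by `η^(12m)`, are modular on `Γ(10)`.

By Ramanujan's identities, `E₂ A + B` solves the fourth order equation as soon as two identities
between iterated Serre derivatives hold (`isSolution_of_serre_chain`). For explicit `A`, `B` these
are polynomial identities, checked by evaluation. No exponent exceeds `α` by a positive integer, so
`f` is proportional to `E₂ A + B`. The factor is non-zero because `E₂` is not a quotient of modular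
forms (`isQuasimodularOfPositiveDepth_of_isQuasiDatum`). -/

noncomputable section

namespace MLDE

/-! ### Series in `q` with a rational leading exponent -/

/-- `f(τ) = ∑ aₙ q^(β + n)` on the upper half-plane. -/
def HasQSeries (β : ℚ) (a : ℕ → ℂ) (f : ℍ → ℂ) : Prop :=
  ∀ τ : ℍ, HasSum (fun n : ℕ =>
    a n * Complex.exp (2 * Real.pi * Complex.I * ((β : ℂ) + (n : ℂ)) * (τ : ℂ))) (f τ)

lemma norm_cexp_qpow (x : ℝ) (w : ℂ) :
    ‖Complex.exp (2 * Real.pi * Complex.I * (x : ℂ) * w)‖ = Real.exp (-2 * Real.pi * x * w.im) := by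
  rw [Complex.norm_exp]
  congr 1
  simp [Complex.mul_re, Complex.mul_im]

lemma cexp_qpow_add (β : ℂ) (n : ℕ) (w : ℂ) :
    Complex.exp (2 * Real.pi * Complex.I * (β + n) * w) =
      Complex.exp (2 * Real.pi * Complex.I * β * w) *
        Complex.exp (2 * Real.pi * Complex.I * w) ^ n := by
  rw [← Complex.exp_nat_mul, ← Complex.exp_add]
  ring_nf

namespace HasQSeries

variable {β β' : ℚ} {a b : ℕ → ℂ} {f g : ℍ → ℂ}

lemma add (hf : HasQSeries β a f) (hg : HasQSeries β b g) :
    HasQSeries β (fun n => a n + b n) (fun τ => f τ + g τ) := fun τ => by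
  simpa only [add_mul] using (hf τ).add (hg τ)

lemma const_mul (c : ℂ) (hf : HasQSeries β a f) :
    HasQSeries β (fun n => c * a n) (fun τ => c * f τ) := fun τ => by
  simpa only [mul_assoc] using (hf τ).mul_left c

lemma sub (hf : HasQSeries β a f) (hg : HasQSeries β b g) :
    HasQSeries β (fun n => a n - b n) (fun τ => f τ - g τ) := fun τ => by
  simpa only [sub_mul] using (hf τ).sub (hg τ)

lemma mul (hf : HasQSeries β a f) (hg : HasQSeries β' b g) :
    HasQSeries (β + β') (fun n => ∑ p ∈ Finset.HasAntidiagonal.antidiagonal n, a p.1 * b p.2)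
      (fun τ => f τ * g τ) := fun τ => by
  have h1 := (hf τ).summable.norm
  have h2 := (hg τ).summable.norm
  have h := (summable_norm_sum_mul_antidiagonal_of_summable_norm h1 h2).of_norm.hasSum
  rw [← tsum_mul_tsum_eq_tsum_sum_antidiagonal_of_summable_norm h1 h2, (hf τ).tsum_eq,
    (hg τ).tsum_eq] at h
  convert! h using 2 with n
  rw [Finset.sum_mul]
  refine Finset.sum_congr rfl fun p hp => ?_
  rw [← Finset.HasAntidiagonal.mem_antidiagonal.mp hp]
  push_cast
  rw [mul_mul_mul_comm, ← Complex.exp_add]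
  ring_nf

lemma of_eq (hf : HasQSeries β a f) (hβ : β = β') (hab : ∀ n, a n = b n) (hfg : ∀ τ, f τ = g τ) :
    HasQSeries β' b g := by
  obtain rfl := hβ
  obtain rfl : a = b := funext hab
  obtain rfl : f = g := funext hfg
  exact hf

lemma hasSum_ofComplex (hf : HasQSeries β a f) {w : ℂ} (hw : 0 < w.im) :
    HasSum (fun n : ℕ => a n * Complex.exp (2 * Real.pi * Complex.I * ((β : ℂ) + (n : ℂ)) * w))
      ((f ∘ ofComplex) w) := by
  have := hf ⟨w, hw⟩
  simpa [ofComplex_apply_of_im_pos hw] using! this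

/-- On a horizontal strip the terms are dominated by those at `i y`. The extra exponential factor
absorbs `q^β`, whose absolute value increases with the imaginary part when `β < 0`. This is the
bound needed for termwise differentiation. -/
lemma aux_bound (hf : HasQSeries β a f) {y Y : ℝ} (hy : 0 < y) :
    ∃ u : ℕ → ℝ, Summable u ∧ ∀ (n : ℕ) (w : ℂ), w ∈ {w : ℂ | y < w.im ∧ w.im < Y} →
      ‖a n * Complex.exp (2 * Real.pi * Complex.I * ((β : ℂ) + (n : ℂ)) * w)‖ ≤ u n := by
  have h := (hf.hasSum_ofComplex (w := Complex.I * y) (by simpa using hy)).summable.norm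
  refine ⟨_, h.mul_right (Real.exp (2 * Real.pi * |(β : ℝ)| * (Y + y))), fun n w hw => ?_⟩
  have e : ((β : ℂ) + (n : ℂ)) = (((β : ℝ) + n : ℝ) : ℂ) := by push_cast; rfl
  rw [norm_mul, norm_mul, e, norm_cexp_qpow, norm_cexp_qpow, mul_assoc ‖a n‖, ← Real.exp_add]
  gcongr
  simp only [Complex.mul_im, Complex.I_re, Complex.I_im, Complex.ofReal_re, Complex.ofReal_im]
  have h1 : 0 ≤ (n : ℝ) * (w.im - y) := mul_nonneg (by positivity) (by linarith [hw.1])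
  have h2 : -(β : ℝ) * (w.im - y) ≤ |(β : ℝ)| * (Y + y) := by
    refine (mul_le_mul_of_nonneg_right (neg_le_abs _) (by linarith [hw.1])).trans ?_
    gcongr
    linarith [hw.2]
  nlinarith [Real.pi_pos]

lemma mdiff_and_deriv (hf : HasQSeries β a f) :
    MDiff f ∧ HasQSeries β (fun n => ((β : ℂ) + n) * a n) (qD f) := by
  have key : ∀ z : ℂ, 0 < z.im → DifferentiableAt ℂ (f ∘ ofComplex) z ∧
      HasSum (fun n : ℕ => a n * ((2 * Real.pi * Complex.I * ((β : ℂ) + (n : ℂ))) *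
        Complex.exp (2 * Real.pi * Complex.I * ((β : ℂ) + (n : ℂ)) * z)))
        (deriv (f ∘ ofComplex) z) := by
    intro z hz
    set U : Set ℂ := {w : ℂ | z.im / 2 < w.im ∧ w.im < z.im + 1}
    obtain ⟨u, hu, hb⟩ := hf.aux_bound (y := z.im / 2) (Y := z.im + 1) (by linarith)
    have hU : IsOpen U :=
      (isOpen_lt continuous_const Complex.continuous_im).inter
        (isOpen_lt Complex.continuous_im continuous_const)
    have hzU : z ∈ U := ⟨by linarith, by linarith⟩
    have hd : ∀ n : ℕ, Differentiable ℂ (fun w : ℂ => a n *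
        Complex.exp (2 * Real.pi * Complex.I * ((β : ℂ) + (n : ℂ)) * w)) := fun n => by fun_prop
    have heq : (fun w : ℂ => ∑' n : ℕ, a n *
        Complex.exp (2 * Real.pi * Complex.I * ((β : ℂ) + (n : ℂ)) * w)) =ᶠ[nhds z]
        f ∘ ofComplex := by
      filter_upwards [hU.mem_nhds hzU] with w hw
      exact (hf.hasSum_ofComplex (w := w) (by linarith [hw.1])).tsum_eq
    have h1 := Complex.hasSum_deriv_of_summable_norm hu (fun n => (hd n).differentiableOn) hU hb hzU
    have h2 := (Complex.differentiableOn_tsum_of_summable_norm hu (fun n => (hd n).differentiableOn)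
      hU hb).differentiableAt (hU.mem_nhds hzU)
    refine ⟨h2.congr_of_eventuallyEq heq.symm, ?_⟩
    rw [heq.deriv_eq] at h1
    convert! h1 using 2 with n
    have h3 : HasDerivAt (fun w : ℂ => 2 * Real.pi * Complex.I * ((β : ℂ) + (n : ℂ)) * w)
        (2 * Real.pi * Complex.I * ((β : ℂ) + (n : ℂ))) z := by
      simpa using (hasDerivAt_id z).const_mul (2 * Real.pi * Complex.I * ((β : ℂ) + (n : ℂ)))
    rw [((h3.cexp).const_mul (a n)).deriv]
    ring
  refine ⟨UpperHalfPlane.mdifferentiable_iff.mpr fun z hz =>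
    (key z hz).1.differentiableWithinAt, fun τ => ?_⟩
  have h := ((key τ τ.im_pos).2).mul_left ((2 * Real.pi * Complex.I)⁻¹)
  convert! h using 2 with n
  have := Complex.two_pi_I_ne_zero
  field_simp

lemma mdiff (hf : HasQSeries β a f) : MDiff f := hf.mdiff_and_deriv.1

lemma deriv (hf : HasQSeries β a f) :
    HasQSeries β (fun n => ((β : ℂ) + n) * a n) (qD f) := hf.mdiff_and_deriv.2

/-- After division by `q^β` this is uniqueness of the `q`-expansion of the zero modular form. -/
lemma eq_zero (hf : HasQSeries β a 0) (n : ℕ) : a n = 0 := by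
  have hs : ∀ τ : ℍ, HasSum (fun m : ℕ => a m • Function.Periodic.qParam (1 : ℝ) τ ^ m)
      ((0 : ℍ → ℂ) τ) := fun τ => by
    have h := (hf τ).mul_left (Complex.exp (2 * Real.pi * Complex.I * β * τ))⁻¹
    simp only [Pi.zero_apply, mul_zero] at h ⊢
    convert! h using 2 with m
    rw [cexp_qpow_add]
    have := Complex.exp_ne_zero (2 * Real.pi * Complex.I * β * τ)
    simp only [Function.Periodic.qParam, smul_eq_mul, Complex.ofReal_one, div_one]
    field_simp
  have h := ModularFormClass.qExpansion_coeff_unique one_pos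
    (Γ := 𝒮ℒ) (by simp) (f := (0 : ModularForm 𝒮ℒ 0)) hs n
  rw [h]
  simp [UpperHalfPlane.qExpansion_zero]

lemma eq_zero_of_coeff (hf : HasQSeries β a f) (ha : ∀ n, a n = 0) : f = 0 := by
  funext τ
  have := hf τ
  simp only [ha, zero_mul] at this
  exact this.unique hasSum_zero

lemma shift (hf : HasQSeries β a f) (N : ℕ) (h0 : ∀ n < N, a n = 0) :
    HasQSeries (β + N) (fun n => a (n + N)) f := fun τ => by
  have h := (hasSum_nat_add_iff' N).mpr (hf τ)
  rw [Finset.sum_eq_zero (fun i hi => by rw [h0 i (Finset.mem_range.mp hi), zero_mul]),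
    sub_zero] at h
  convert! h using 2 with n
  push_cast
  ring_nf

/-- A function given by a `q`-series grows at most exponentially at `i∞`. -/
lemma isBigO (hf : HasQSeries β a f) :
    f =O[atImInfty] fun τ : ℍ => Real.exp (-(2 * Real.pi * β) * τ.im) := by
  have h := (hf UpperHalfPlane.I).summable.norm
  refine Asymptotics.IsBigO.of_bound
    ((∑' n : ℕ, ‖a n * Complex.exp (2 * Real.pi * Complex.I * ((β : ℂ) + (n : ℂ)) *
      (UpperHalfPlane.I : ℍ))‖) * Real.exp (2 * Real.pi * β)) ?_
  rw [Filter.eventually_iff, UpperHalfPlane.atImInfty_mem]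
  refine ⟨1, fun τ hτ => ?_⟩
  have hle : ∀ n : ℕ,
      ‖a n * Complex.exp (2 * Real.pi * Complex.I * ((β : ℂ) + (n : ℂ)) * (τ : ℂ))‖ ≤
      ‖a n * Complex.exp (2 * Real.pi * Complex.I * ((β : ℂ) + (n : ℂ)) *
        (UpperHalfPlane.I : ℍ))‖ *
        (Real.exp (2 * Real.pi * β) * Real.exp (-(2 * Real.pi * β) * τ.im)) := fun n => by
    have e : ((β : ℂ) + (n : ℂ)) = (((β : ℝ) + n : ℝ) : ℂ) := by push_cast; rfl
    rw [norm_mul, norm_mul, e, norm_cexp_qpow, norm_cexp_qpow, mul_assoc ‖a n‖, ← Real.exp_add,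
      ← Real.exp_add]
    gcongr
    simp only [UpperHalfPlane.coe_im, UpperHalfPlane.I_im]
    have h1 : 0 ≤ (n : ℝ) * (τ.im - 1) := mul_nonneg (by positivity) (by linarith)
    nlinarith [Real.pi_pos]
  have h3 := tsum_of_norm_bounded (h.mul_right
    (Real.exp (2 * Real.pi * β) * Real.exp (-(2 * Real.pi * β) * τ.im))).hasSum hle
  rw [(hf τ).tsum_eq, tsum_mul_right] at h3
  simpa [mul_assoc] using h3

end HasQSeries

/-- A function analytic in `q` on the unit disc, times a power of `q`, is a `q`-series. -/
lemma exists_hasQSeries_of_differentiableOn {F : ℂ → ℂ} (β : ℚ)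
    (hF : DifferentiableOn ℂ F (Metric.ball 0 1)) :
    ∃ a : ℕ → ℂ, a 0 = F 0 ∧ HasQSeries β a (fun τ =>
      Complex.exp (2 * Real.pi * Complex.I * β * τ) *
        F (Complex.exp (2 * Real.pi * Complex.I * τ))) := by
  refine ⟨fun n => (n.factorial : ℂ)⁻¹ • iteratedDeriv n F 0, by simp, fun τ => ?_⟩
  have h := Complex.hasSum_taylorSeries_on_ball hF
    (z := Complex.exp (2 * Real.pi * Complex.I * τ))
    (by simpa using UpperHalfPlane.norm_exp_two_pi_I_lt_one τ)
  have h2 := h.mul_left (Complex.exp (2 * Real.pi * Complex.I * β * τ))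
  convert! h2 using 2 with n
  rw [cexp_qpow_add]
  simp only [smul_eq_mul, sub_zero]
  ring

lemma hasQSeries_of_hasSum_pow {a : ℕ → ℂ} {f : ℍ → ℂ}
    (h : ∀ τ : ℍ, HasSum (fun n : ℕ => a n * Complex.exp (2 * Real.pi * Complex.I * τ) ^ n) (f τ)) :
    HasQSeries 0 a f := fun τ => by
  convert! h τ using 2 with n
  rw [cexp_qpow_add]
  simp

/-! ### Calculus of the derivation `D` -/

/-- `f` is holomorphic with `D f = g`. -/
structure HasD (f g : ℍ → ℂ) : Prop where
  mdiff : MDiff f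
  deriv : ∀ τ, qD f τ = g τ

namespace HasD

variable {f f' g g' : ℍ → ℂ}

lemma self (hf : MDiff f) : HasD f (qD f) := ⟨hf, fun _ => rfl⟩

lemma qD_eq (h : HasD f f') : qD f = f' := funext h.deriv

lemma congr (h : HasD f f') (hf : ∀ τ, f τ = g τ) (hf' : ∀ τ, f' τ = g' τ) : HasD g g' := by
  obtain rfl : f = g := funext hf
  exact ⟨h.mdiff, fun τ => (h.deriv τ).trans (hf' τ)⟩

lemma add (hf : HasD f f') (hg : HasD g g') :
    HasD (fun τ => f τ + g τ) (fun τ => f' τ + g' τ) :=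
  ⟨hf.mdiff.add hg.mdiff, fun τ => by
    have := congrFun (Derivative.normalizedDerivOfComplex_add f g hf.mdiff hg.mdiff) τ
    rw [← hf.deriv, ← hg.deriv]
    exact this⟩

lemma mul (hf : HasD f f') (hg : HasD g g') :
    HasD (fun τ => f τ * g τ) (fun τ => f' τ * g τ + f τ * g' τ) :=
  ⟨hf.mdiff.mul hg.mdiff, fun τ => by
    have := congrFun (Derivative.normalizedDerivOfComplex_mul f g hf.mdiff hg.mdiff) τ
    rw [← hf.deriv, ← hg.deriv]
    exact this⟩

lemma const (c : ℂ) : HasD (fun _ => c) (fun _ => 0) :=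
  ⟨mdifferentiable_const, fun τ => congrFun (Derivative.normalizedDerivOfComplex_const c) τ⟩

lemma const_mul (c : ℂ) (hf : HasD f f') : HasD (fun τ => c * f τ) (fun τ => c * f' τ) :=
  ((const c).mul hf).congr (fun _ => rfl) (fun τ => by ring)

lemma sub (hf : HasD f f') (hg : HasD g g') :
    HasD (fun τ => f τ - g τ) (fun τ => f' τ - g' τ) :=
  (hf.add (hg.const_mul (-1))).congr (fun τ => by ring) (fun τ => by ring)

lemma pow (hf : HasD f f') (n : ℕ) :
    HasD (fun τ => f τ ^ n) (fun τ => n * f τ ^ (n - 1) * f' τ) := by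
  induction n with
  | zero => exact (const 1).congr (fun τ => by simp) (fun τ => by simp)
  | succ n ih =>
    refine (ih.mul hf).congr (fun τ => (pow_succ _ _).symm) (fun τ => ?_)
    rcases n with _ | n
    · simp
    · simp only [Nat.add_sub_cancel]
      push_cast
      ring

end HasD

lemma hasD_inv {f f' : ℍ → ℂ} (hf : HasD f f') (h0 : ∀ τ, f τ ≠ 0) :
    HasD (fun τ => (f τ)⁻¹) (fun τ => -f' τ / f τ ^ 2) := by
  have h1 : MDiff (fun τ => (f τ)⁻¹) := by
    have := hf.mdiff
    rw [UpperHalfPlane.mdifferentiable_iff] at this ⊢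
    exact this.inv fun z _ => h0 _
  refine ⟨h1, fun τ => ?_⟩
  have h2 := (hf.mul (HasD.self h1)).deriv τ
  have h3 : (fun τ => f τ * (f τ)⁻¹) = fun _ => (1 : ℂ) :=
    funext fun τ => mul_inv_cancel₀ (h0 τ)
  rw [h3, (HasD.const 1).deriv] at h2
  have := h0 τ
  field_simp at h2 ⊢
  linear_combination -h2

/-! ### Eisenstein series and Ramanujan's identities -/

/-- Coefficients of the `q`-expansions of `E₂`, `E₄`, `E₆`, `E₈`. -/
def eisCoeff (c : ℤ) (k n : ℕ) : ℤ := if n = 0 then 1 else c * ArithmeticFunction.sigma k n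

lemma eisCoeff_zero (c : ℤ) (k : ℕ) : eisCoeff c k 0 = 1 := rfl

lemma hasQSeries_eis2 : HasQSeries 0 (fun n => (eisCoeff (-24) 1 n : ℂ)) eis2 :=
  hasQSeries_of_hasSum_pow fun τ => by
    convert! EisensteinSeries.hasSum_qExpansion_E2 (z := τ) using 2 with n
    simp only [eisCoeff, smul_eq_mul]
    split_ifs <;> push_cast <;> rfl

lemma hasQSeries_eis {k : ℕ} (hk : 3 ≤ k) (hk2 : Even k) (c : ℤ)
    (hc : -(2 * k / bernoulli k : ℂ) = c) :
    HasQSeries 0 (fun n => (eisCoeff c (k - 1) n : ℂ)) (ModularForm.E hk) :=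
  hasQSeries_of_hasSum_pow fun τ => by
    have h := ModularForm.hasSum_qExpansion (f := ModularForm.E hk) one_pos
      one_mem_strictPeriods_SL τ
    convert! h using 2 with n
    rw [EisensteinSeries.E_qExpansion_coeff hk hk2, hc]
    simp only [eisCoeff, Function.Periodic.qParam, Complex.ofReal_one, div_one]
    split_ifs <;> push_cast <;> rfl

lemma hasQSeries_eis4 : HasQSeries 0 (fun n => (eisCoeff 240 3 n : ℂ)) eis4 :=
  hasQSeries_eis (by norm_num) ⟨2, rfl⟩ 240 (by
    norm_num [show bernoulli 4 = -1 / 30 by decide +kernel])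

lemma hasQSeries_eis6 : HasQSeries 0 (fun n => (eisCoeff (-504) 5 n : ℂ)) eis6 :=
  hasQSeries_eis (by norm_num) ⟨3, rfl⟩ (-504) (by
    norm_num [show bernoulli 6 = 1 / 42 by decide +kernel])

lemma hasQSeries_eis8 : HasQSeries 0 (fun n => (eisCoeff 480 7 n : ℂ)) eis8 :=
  hasQSeries_eis (by norm_num) ⟨4, rfl⟩ 480 (by
    norm_num [show bernoulli 8 = -1 / 30 by decide +kernel])

lemma slash_eis {k : ℕ} (hk : 3 ≤ k) (γ : SL(2, ℤ)) :
    (ModularForm.E hk : ℍ → ℂ) ∣[(k : ℤ)] γ = ModularForm.E hk :=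
  SlashInvariantForm.slash_action_eqn _ _ (MonoidHom.mem_range.mpr ⟨γ, rfl⟩)

lemma slash_eis4 (γ : SL(2, ℤ)) : eis4 ∣[(4 : ℤ)] γ = eis4 := slash_eis (k := 4) _ γ

lemma slash_eis6 (γ : SL(2, ℤ)) : eis6 ∣[(6 : ℤ)] γ = eis6 := slash_eis (k := 6) _ γ

lemma slash_eis8 (γ : SL(2, ℤ)) : eis8 ∣[(8 : ℤ)] γ = eis8 := slash_eis (k := 8) _ γ

lemma slash_eis2 (γ : SL(2, ℤ)) (τ : ℍ) : (eis2 ∣[(2 : ℤ)] γ) τ =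
    eis2 τ + 12 * (2 * Real.pi * Complex.I)⁻¹ * (γ 1 0 / denom γ τ) := by
  rw [EisensteinSeries.E2_slash_action]
  simp only [Pi.sub_apply, Pi.smul_apply, EisensteinSeries.D2, riemannZeta_two, smul_eq_mul]
  have : (Real.pi : ℂ) ≠ 0 := by exact_mod_cast Real.pi_ne_zero
  have hd := denom_ne_zero γ τ
  have hI := Complex.I_sq
  field_simp
  linear_combination (-12 * (γ 1 0 : ℂ)) * hI

/-- A level one form of weight `< 12` vanishing at the cusp is zero. -/
lemma eq_zero_of_levelOne {k : ℕ} (hk : k < 12) {F : ℍ → ℂ} {a : ℕ → ℂ} (hF : HasQSeries 0 a F)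
    (ha : a 0 = 0) (hslash : ∀ γ : SL(2, ℤ), F ∣[(k : ℤ)] γ = F) : F = 0 := by
  let G : ModularForm 𝒮ℒ k :=
    { toFun := F
      slash_action_eq' := by
        rintro A ⟨γ, rfl⟩
        exact hslash γ
      holo' := hF.mdiff
      bdd_at_cusps' := by
        intro c hc
        rw [OnePoint.isBoundedAt_iff_forall_SL2Z hc]
        intro γ _
        rw [hslash γ, UpperHalfPlane.IsBoundedAtImInfty, Filter.BoundedAtFilter]
        exact hF.isBigO.congr_right fun τ => by simp }
  have hcoef : (UpperHalfPlane.qExpansion 1 G).coeff 0 = 0 := by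
    rw [← ha]
    refine (ModularFormClass.qExpansion_coeff_unique one_pos one_mem_strictPeriods_SL
      (fun τ => ?_) 0).symm
    convert! hF τ using 2 with n
    rw [cexp_qpow_add]
    simp [Function.Periodic.qParam]
  have hG : G = 0 := by
    refine ModularForm.sturm_bound_levelOne_nat ?_
    rw [Nat.div_eq_of_lt hk]
    refine lt_of_lt_of_le (b := ((1 : ℕ) : ℕ∞)) (by norm_num)
      (PowerSeries.nat_le_order _ 1 fun i hi => ?_)
    obtain rfl : i = 0 := by omega
    exact hcoef
  exact congrArg (fun G : ModularForm 𝒮ℒ k => (G : ℍ → ℂ)) hG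

lemma smul_slash_fun (k : ℤ) (γ : SL(2, ℤ)) (f : ℍ → ℂ) (c : ℂ) :
    (fun τ => c * f τ) ∣[k] γ = fun τ => c * (f ∣[k] γ) τ :=
  ModularForm.SL_smul_slash k γ f c

lemma mul_slash_fun (k₁ k₂ : ℤ) (γ : SL(2, ℤ)) (f g : ℍ → ℂ) :
    (fun τ => f τ * g τ) ∣[k₁ + k₂] γ = fun τ => (f ∣[k₁] γ) τ * (g ∣[k₂] γ) τ :=
  ModularForm.mul_slash_SL2 k₁ k₂ γ f g

lemma add_slash_fun (k : ℤ) (γ : SL(2, ℤ)) (f g : ℍ → ℂ) :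
    (fun τ => f τ + g τ) ∣[k] γ = fun τ => (f ∣[k] γ) τ + (g ∣[k] γ) τ :=
  SlashAction.add_slash k γ f g

lemma antidiag_zero (F : ℕ × ℕ → ℂ) :
    ∑ p ∈ Finset.HasAntidiagonal.antidiagonal 0, F p = F (0, 0) := by simp

lemma eis8_eq (τ : ℍ) : eis8 τ = eis4 τ ^ 2 := by
  have h := (hasQSeries_eis8.sub ((hasQSeries_eis4.mul hasQSeries_eis4).of_eq (add_zero 0)
    (fun _ => rfl) (fun _ => rfl))).of_eq (g := fun τ => eis8 τ + (-1) * (eis4 τ * eis4 τ)) rfl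
    (fun _ => rfl) (fun τ => by ring)
  have h0 := eq_zero_of_levelOne (k := 8) (by norm_num) h (by simp [eisCoeff_zero])
    (fun γ => by
      rw [add_slash_fun, smul_slash_fun]
      have := mul_slash_fun 4 4 γ eis4 eis4
      norm_num at this
      simp only [Nat.cast_ofNat, this, slash_eis4, slash_eis8])
  have := congrFun h0 τ
  simp only [Pi.zero_apply] at this
  linear_combination this

/-- The Serre derivative of `E₄` is modular of weight 6 with constant term `-1/3`. Adding `E₆ / 3`
gives a form that vanishes at the cusp, hence is zero. The identity for `E₆` is obtained in the same
way in weight 8. -/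
lemma hasD_eis4 : HasD eis4 (fun τ => (eis2 τ * eis4 τ - eis6 τ) / 3) := by
  refine ⟨hasQSeries_eis4.mdiff, fun τ => ?_⟩
  have h := ((hasQSeries_eis4.deriv.sub (((hasQSeries_eis2.mul hasQSeries_eis4).of_eq (add_zero 0)
    (fun _ => rfl) (fun _ => rfl)).const_mul (1 / 3))).add
    (hasQSeries_eis6.const_mul (1 / 3))).of_eq
    (g := fun τ => Derivative.serreDerivative (4 : ℤ) eis4 τ + (1 / 3) * eis6 τ) rfl
    (fun _ => rfl) (fun τ => by simp; ring)
  have h0 := eq_zero_of_levelOne (k := 6) (by norm_num) h (by simp [eisCoeff_zero])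
    (fun γ => by
      have := Derivative.serreDerivative_slash_invariant hasQSeries_eis4.mdiff (slash_eis4 γ)
      norm_num only at this
      rw [add_slash_fun, smul_slash_fun]
      simp only [Nat.cast_ofNat, slash_eis6]
      erw [this]
      norm_num)
  have := congrFun h0 τ
  simp at this
  linear_combination this

lemma hasD_eis6 : HasD eis6 (fun τ => (eis2 τ * eis6 τ - eis4 τ ^ 2) / 2) := by
  refine ⟨hasQSeries_eis6.mdiff, fun τ => ?_⟩
  have h := ((hasQSeries_eis6.deriv.sub (((hasQSeries_eis2.mul hasQSeries_eis6).of_eq (add_zero 0)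
    (fun _ => rfl) (fun _ => rfl)).const_mul (1 / 2))).add
    (hasQSeries_eis8.const_mul (1 / 2))).of_eq
    (g := fun τ => Derivative.serreDerivative (6 : ℤ) eis6 τ + (1 / 2) * eis8 τ) rfl
    (fun _ => rfl) (fun τ => by simp; ring)
  have h0 := eq_zero_of_levelOne (k := 8) (by norm_num) h (by simp [eisCoeff_zero])
    (fun γ => by
      have := Derivative.serreDerivative_slash_invariant hasQSeries_eis6.mdiff (slash_eis6 γ)
      norm_num only at this
      rw [add_slash_fun, smul_slash_fun]
      simp only [Nat.cast_ofNat, slash_eis8]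
      erw [this]
      norm_num)
  have := congrFun h0 τ
  simp [eis8_eq] at this
  linear_combination this

/-- `1 / (cτ + d)` is the constant 1 slashed in weight 1, so its derivative is the correction term
in the commutation of `D` with the slash action. -/
lemma hasD_div_denom (γ : SL(2, ℤ)) : HasD (fun τ : ℍ => (γ 1 0 : ℂ) / denom γ τ)
    (fun τ => -(2 * Real.pi * Complex.I)⁻¹ * ((γ 1 0 : ℂ) / denom γ τ) ^ 2) := by
  have h1 : ∀ τ : ℍ, ((fun _ => (1 : ℂ)) ∣[(1 : ℤ)] γ : ℍ → ℂ) τ = (denom γ τ)⁻¹ := fun τ => by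
    rw [ModularForm.SL_slash_apply]
    simp
  have hm : MDiff (fun τ : ℍ => (denom γ τ)⁻¹) := by
    rw [UpperHalfPlane.mdifferentiable_iff]
    have : DifferentiableOn ℂ (fun w : ℂ => ((γ 1 0 : ℂ) * w + (γ 1 1 : ℂ))⁻¹)
        UpperHalfPlane.upperHalfPlaneSet := by
      refine DifferentiableOn.inv (by fun_prop) fun w hw => ?_
      have := denom_ne_zero γ ⟨w, hw⟩
      simpa [denom] using this
    refine this.congr fun w hw => ?_
    simp [denom, ofComplex_apply_of_im_pos hw]
  have hD : HasD (fun τ : ℍ => (denom γ τ)⁻¹)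
      (fun τ => -(2 * Real.pi * Complex.I)⁻¹ * ((γ 1 0 : ℂ) / denom γ τ) * (denom γ τ)⁻¹) := by
    refine ⟨hm, fun τ => ?_⟩
    have h := congrFun (Derivative.normalizedDerivOfComplex_SL_slash (k := 1) (γ := γ)
      (HasD.const 1).mdiff) τ
    have h0 : Derivative.normalizedDerivOfComplex (fun _ : ℍ => (1 : ℂ)) = 0 :=
      Derivative.normalizedDerivOfComplex_const 1
    rw [h0, SlashAction.zero_slash] at h
    rw [show ((fun _ => (1 : ℂ)) ∣[(1 : ℤ)] γ : ℍ → ℂ) = fun τ : ℍ => (denom γ τ)⁻¹ from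
      funext h1] at h
    rw [qD, h]
    simp
  refine (hD.const_mul (γ 1 0 : ℂ)).congr (fun τ => (div_eq_mul_inv _ _).symm) (fun τ => ?_)
  ring

/-- Neither `D E₂` nor `E₂²` is modular, but the terms in `c / (cτ + d)` cancel in `D E₂ - E₂² /
12`. Thus `D E₂ - E₂² / 12 + E₄ / 12` is modular of weight 4 with vanishing constant term. -/
lemma hasD_eis2 : HasD eis2 (fun τ => (eis2 τ ^ 2 - eis4 τ) / 12) := by
  refine ⟨hasQSeries_eis2.mdiff, fun τ => ?_⟩
  have h := (hasQSeries_eis2.deriv.add ((((hasQSeries_eis2.mul hasQSeries_eis2).of_eq (add_zero 0)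
    (fun _ => rfl) (fun _ => rfl)).const_mul (-1 / 12)).add (hasQSeries_eis4.const_mul (1 / 12))))
  have h0 := eq_zero_of_levelOne (k := 4) (by norm_num) h (by simp [eisCoeff_zero]; norm_num)
    (fun γ => by
      have e1 : eis2 ∣[(2 : ℤ)] γ = fun τ => eis2 τ +
        12 * (2 * Real.pi * Complex.I)⁻¹ * (γ 1 0 / denom γ τ) := funext (slash_eis2 γ)
      have e2 := Derivative.normalizedDerivOfComplex_SL_slash (k := 2) (γ := γ)
        hasQSeries_eis2.mdiff
      have e3 := mul_slash_fun 2 2 γ eis2 eis2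
      have e4 := ((HasD.self hasQSeries_eis2.mdiff).add
        ((hasD_div_denom γ).const_mul (12 * (2 * Real.pi * Complex.I)⁻¹))).qD_eq
      rw [e1] at e2 e3
      norm_num only at e2 e3
      rw [show Derivative.normalizedDerivOfComplex (fun τ : ℍ => eis2 τ +
        12 * (2 * Real.pi * Complex.I)⁻¹ * (γ 1 0 / denom γ τ)) = _ from e4] at e2
      rw [add_slash_fun, add_slash_fun, smul_slash_fun, smul_slash_fun]
      funext τ
      have e5 := congrFun e2 τ
      simp only [Pi.sub_apply] at e5
      simp only [Nat.cast_ofNat, slash_eis4, e3]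
      linear_combination -e5)
  have := congrFun h0 τ
  simp only [Pi.zero_apply] at this
  linear_combination this

lemma HasQSeries.slash_T {β : ℚ} {a : ℕ → ℂ} {f : ℍ → ℂ} (hf : HasQSeries β a f) (k : ℤ) (τ : ℍ) :
    (f ∣[k] ModularGroup.T) τ = Complex.exp (2 * Real.pi * Complex.I * β) * f τ := by
  rw [ModularForm.SL_slash_apply, modular_T_smul]
  have h1 := hf ((1 : ℝ) +ᵥ τ)
  have h2 := (hf τ).mul_left (Complex.exp (2 * Real.pi * Complex.I * β))
  have : denom ModularGroup.T τ = 1 := by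
    rw [ModularGroup.denom_apply]; simp [ModularGroup.T]
  rw [this, one_zpow, mul_one]
  refine h1.unique ?_
  convert! h2 using 2 with n
  have : Complex.exp (2 * Real.pi * Complex.I * n) = 1 := by
    rw [mul_comm]; exact Complex.exp_nat_mul_two_pi_mul_I n
  rw [UpperHalfPlane.coe_vadd, show 2 * (Real.pi : ℂ) * Complex.I * ((β : ℂ) + n) *
    (((1 : ℝ) : ℂ) + τ) = 2 * Real.pi * Complex.I * β + 2 * Real.pi * Complex.I * n +
      2 * Real.pi * Complex.I * ((β : ℂ) + n) * τ by push_cast; ring, Complex.exp_add,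
    Complex.exp_add, this]
  ring

/-! ### Powers of `η¹²` -/

/-- The twelfth power of the Dedekind eta function. -/
def eta12 (τ : ℍ) : ℂ := ModularForm.eta τ ^ 12

lemma eta12_ne_zero (τ : ℍ) : eta12 τ ≠ 0 := pow_ne_zero _ (ModularForm.eta_ne_zero τ.2)

lemma eta12_eq (τ : ℍ) : eta12 τ = Complex.exp (2 * Real.pi * Complex.I * (1 / 2 : ℚ) * τ) *
    (∏' n : ℕ, (1 - Complex.exp (2 * Real.pi * Complex.I * τ) ^ (n + 1))) ^ 12 := by
  have h1 : Function.Periodic.qParam 24 (τ : ℂ) ^ 12 =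
      Complex.exp (2 * Real.pi * Complex.I * (1 / 2 : ℚ) * τ) := by
    rw [Function.Periodic.qParam, ← Complex.exp_nat_mul]
    congr 1
    push_cast
    ring
  have h2 : ∏' n : ℕ, (1 - ModularForm.eta_q n τ) =
      ∏' n : ℕ, (1 - Complex.exp (2 * Real.pi * Complex.I * τ) ^ (n + 1)) :=
    tprod_congr fun n => by rw [ModularForm.eta_q_eq_pow]
  rw [eta12, ModularForm.eta, h2, mul_pow, h1]

lemma hasD_eta12 : HasD eta12 (fun τ => eis2 τ / 2 * eta12 τ) := by
  have h1 : HasD (fun τ : ℍ => ModularForm.eta τ)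
      (fun τ => eis2 τ / 24 * ModularForm.eta τ) := by
    refine ⟨?_, fun τ => ?_⟩
    · rw [UpperHalfPlane.mdifferentiable_iff]
      refine DifferentiableOn.congr (f := ModularForm.eta) (fun z hz =>
        (ModularForm.differentiableAt_eta_of_mem_upperHalfPlaneSet hz).differentiableWithinAt)
        fun z hz => ?_
      simp [ofComplex_apply_of_im_pos hz]
    · have h := ModularForm.logDeriv_eta_eq_E2 τ
      have h0 := ModularForm.eta_ne_zero τ.2
      rw [logDeriv_apply, div_eq_iff h0] at h
      have heq : (fun τ : ℍ => ModularForm.eta τ) ∘ ofComplex =ᶠ[nhds (τ : ℂ)] ModularForm.eta := by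
        filter_upwards [isOpen_upperHalfPlaneSet.mem_nhds τ.2] with z hz
        simp [ofComplex_apply_of_im_pos hz]
      rw [qD, Derivative.normalizedDerivOfComplex, heq.deriv_eq, h]
      have := Complex.two_pi_I_ne_zero
      have hpi : (Real.pi : ℂ) ≠ 0 := by exact_mod_cast Real.pi_ne_zero
      field_simp
      ring
  exact (h1.pow 12).congr (fun _ => rfl) (fun τ => by simp only [eta12]; ring)

/-- Negative powers of `η¹²` are `q`-series. -/
lemma exists_hasQSeries_eta12_inv (m : ℕ) : ∃ a : ℕ → ℂ, a 0 = 1 ∧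
    HasQSeries (-m / 2) a (fun τ => (eta12 τ ^ m)⁻¹) := by
  have hd : DifferentiableOn ℂ (fun q : ℂ => ((∏' n : ℕ, (1 - q ^ (n + 1))) ^ (12 * m))⁻¹)
      (Metric.ball 0 1) := by
    refine (ModularForm.differentiableOn_tprod_one_sub_pow.pow _).inv fun q hq => pow_ne_zero _ ?_
    have hq1 : ‖q‖ < 1 := by simpa using hq
    have hs : Summable fun n : ℕ => ‖-q ^ (n + 1)‖ := by
      simpa using (summable_nat_add_iff 1).mpr (summable_geometric_of_lt_one (norm_nonneg q) hq1)
    have := tprod_one_add_ne_zero_of_summable (f := fun n : ℕ => -q ^ (n + 1)) (fun n h => ?_) hs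
    · simpa [sub_eq_add_neg] using! this
    · have h1 : q ^ (n + 1) = 1 := by linear_combination -h
      have h2 : ‖q‖ ^ (n + 1) = 1 := by rw [← norm_pow, h1, norm_one]
      exact absurd h2 (pow_lt_one₀ (norm_nonneg q) hq1 (by omega)).ne
  obtain ⟨a, ha, h⟩ := exists_hasQSeries_of_differentiableOn (-m / 2) hd
  refine ⟨a, by simp [ha], h.of_eq rfl (fun _ => rfl) fun τ => ?_⟩
  rw [eta12_eq, mul_pow, mul_inv, ← pow_mul, ← Complex.exp_nat_mul, ← Complex.exp_neg]
  congr 2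
  push_cast
  ring

/-- The twelfth power turns the square roots in the law for `η` into sixth powers. The sign is `i⁶ =
-1`. -/
lemma slash_S_eta12 : eta12 ∣[(6 : ℤ)] ModularGroup.S = fun τ => -eta12 τ := by
  funext τ
  rw [ModularForm.SL_slash_apply, modular_S_smul, ModularGroup.denom_S]
  have he := ModularForm.eta_comp_eq_csqrt_I_inv τ.2
  have h : ModularForm.eta (-(τ : ℂ))⁻¹ =
      (Complex.sqrt Complex.I)⁻¹ * (Complex.sqrt τ * ModularForm.eta τ) := by
    simpa [neg_div, inv_neg] using he
  have hs : ∀ z : ℂ, z ≠ 0 → Complex.sqrt z ^ 12 = z ^ 6 := fun z hz => by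
    rw [sqrt_eq_exp hz, ← Complex.exp_nat_mul]
    rw [show ((12 : ℕ) : ℂ) * (Complex.log z / 2) = (6 : ℕ) * Complex.log z by push_cast; ring,
      Complex.exp_nat_mul, Complex.exp_log hz]
  simp only [eta12]
  rw [h, mul_pow, mul_pow, inv_pow, hs _ Complex.I_ne_zero, hs _ τ.ne_zero]
  have := τ.ne_zero
  rw [show Complex.I ^ 6 = -1 by rw [show (6 : ℕ) = 4 + 2 by norm_num, pow_add, Complex.I_pow_four]; simp]
  have h6 : (τ : ℂ) ^ (-6 : ℤ) = ((τ : ℂ) ^ 6)⁻¹ := by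
    rw [zpow_neg]; norm_cast
  rw [h6]
  field_simp

lemma slash_T_eta12 : eta12 ∣[(6 : ℤ)] ModularGroup.T = fun τ => -eta12 τ := by
  have hd : DifferentiableOn ℂ (fun q : ℂ => (∏' n : ℕ, (1 - q ^ (n + 1))) ^ 12)
      (Metric.ball 0 1) := ModularForm.differentiableOn_tprod_one_sub_pow.pow _
  obtain ⟨a, -, h⟩ := exists_hasQSeries_of_differentiableOn (1 / 2) hd
  funext τ
  rw [(h.of_eq (g := eta12) rfl (fun _ => rfl) fun τ => (eta12_eq τ).symm).slash_T]
  rw [show 2 * (Real.pi : ℂ) * Complex.I * ((1 / 2 : ℚ) : ℂ) = Real.pi * Complex.I by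
    push_cast; ring, Complex.exp_pi_mul_I]
  ring

/-! ### The recurrence and the indicial polynomial -/

/-- The coefficient of `q^i` in the symbol of the differential operator. -/
def opCoeff (s : ℂ) (i : ℕ) (x : ℂ) : ℂ :=
  (if i = 0 then x ^ 4 else 0) - eisCoeff (-24) 1 i * x ^ 3
    + (3 * i * eisCoeff (-24) 1 i + coeff1 s * eisCoeff 240 3 i) * x ^ 2
    - (i ^ 2 * eisCoeff (-24) 1 i + coeff1 s / 2 * i * eisCoeff 240 3 i
      - coeff2 s * eisCoeff (-504) 5 i) * x
    + coeff3 s * eisCoeff 480 7 i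

lemma sum_antidiagonal_ite_zero (n : ℕ) (F : ℕ → ℂ) :
    ∑ p ∈ Finset.HasAntidiagonal.antidiagonal n, (if p.1 = 0 then F p.2 else 0) = F n := by
  rw [Finset.sum_eq_single (0, n)]
  · simp
  · rintro ⟨i, j⟩ h hne
    have h' := Finset.HasAntidiagonal.mem_antidiagonal.mp h
    simp only at h'
    rw [if_neg]
    rintro rfl
    exact hne (by simp [← h'])
  · intro h
    exact absurd (by simp) h

/-- The recurrence satisfied by the `q`-coefficients of a solution. -/
lemma IsSolution.recurrence {s : ℂ} {f : ℍ → ℂ} (hsol : IsSolution s f) {α : ℚ} {a : ℕ → ℂ}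
    (hf : HasQSeries α a f) (n : ℕ) :
    ∑ p ∈ Finset.HasAntidiagonal.antidiagonal n, opCoeff s p.1 ((α : ℂ) + p.2) * a p.2 = 0 := by
  have m0 : ∀ {c b : ℕ → ℂ} {u v : ℍ → ℂ}, HasQSeries 0 c u → HasQSeries α b v →
      HasQSeries α (fun n => ∑ p ∈ Finset.HasAntidiagonal.antidiagonal n, c p.1 * b p.2)
        (fun τ => u τ * v τ) := fun hu hv =>
    (hu.mul hv).of_eq (zero_add α) (fun _ => rfl) (fun _ => rfl)
  have h1 := hf.deriv
  have h2 := h1.deriv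
  have h3 := h2.deriv
  have h4 := h3.deriv
  have k2 := hasQSeries_eis2.deriv
  have k22 := k2.deriv
  have k4 := hasQSeries_eis4.deriv
  have H := ((((h4.sub (m0 hasQSeries_eis2 h3)).add
    (m0 ((k2.const_mul 3).add (hasQSeries_eis4.const_mul (coeff1 s))) h2)).sub
    (m0 ((k22.add (k4.const_mul (coeff1 s / 2))).sub (hasQSeries_eis6.const_mul (coeff2 s))) h1)).add
    (m0 (hasQSeries_eis8.const_mul (coeff3 s)) hf)).of_eq (g := 0) rfl (fun _ => rfl)
    (fun τ => hsol.2 τ)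
  have h := H.eq_zero n
  rw [← sum_antidiagonal_ite_zero n (fun n => ((α : ℂ) + n) * (((α : ℂ) + n) *
    (((α : ℂ) + n) * (((α : ℂ) + n) * a n)))), ← Finset.sum_sub_distrib,
    ← Finset.sum_add_distrib, ← Finset.sum_sub_distrib, ← Finset.sum_add_distrib] at h
  rw [← h]
  refine Finset.sum_congr rfl fun p _ => ?_
  simp only [opCoeff]
  split_ifs with hp
  · simp only [hp]; push_cast; ring
  · push_cast; ring

lemma opCoeff_zero (s x : ℂ) : opCoeff s 0 x =
    (x - (s + 6) / 24) * (x - (18 - s) / 24) * (x - (5 * s + 6) / 120) *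
      (x + (5 * s + 6) / 120) := by
  simp only [opCoeff, eisCoeff_zero, coeff1, coeff2, coeff3, if_pos]
  push_cast
  ring

/-! ### Exact evaluation of the recurrence over the integers -/

/-- The sum of the `k`-th powers of the divisors of `n` that are at most `m`. -/
def sigmaAux (k n : ℕ) : ℕ → ℕ
  | 0 => 0
  | m + 1 => (bif (n % (m + 1)).beq 0 then (m + 1) ^ k else 0) + sigmaAux k n m

lemma sigmaAux_eq (k n : ℕ) : sigmaAux k n n = ArithmeticFunction.sigma k n := by
  have h : ∀ m, sigmaAux k n m = ∑ d ∈ Finset.Icc 1 m with d ∣ n, d ^ k := fun m => by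
    induction m with
    | zero => rfl
    | succ m ih =>
      rw [sigmaAux, ih, ← Finset.insert_Icc_right_eq_Icc_add_one (by omega : (1:ℕ) ≤ m + 1), Finset.filter_insert]
      by_cases hd : m + 1 ∣ n
      · rw [if_pos hd, Finset.sum_insert (by simp), Nat.mod_eq_zero_of_dvd hd]
        rfl
      · rw [if_neg hd]
        have : (n % (m + 1)).beq 0 = false := by
          rw [Bool.eq_false_iff]
          exact fun h => hd (Nat.dvd_of_mod_eq_zero (Nat.eq_of_beq_eq_true h))
        rw [this]
        simp
  rw [h, ArithmeticFunction.sigma_apply]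
  congr 1

/-- The same numbers as `eisCoeff`, in a form suited to evaluation. -/
def eisEval (c : ℤ) (k n : ℕ) : ℤ := bif n.beq 0 then 1 else c * sigmaAux k n n

lemma eisEval_eq (c : ℤ) (k n : ℕ) : eisEval c k n = eisCoeff c k n := by
  rw [eisEval, eisCoeff, sigmaAux_eq]
  rcases n with _ | n
  · rfl
  · simp [Nat.beq]

/-- The symbol with denominators cleared, where `s = t / 15` and `x = X / 360`. -/
def opInt (t : ℤ) (i : ℕ) (X : ℤ) : ℤ :=
  (bif i.beq 0 then X ^ 4 else 0) - 360 * eisEval (-24) 1 i * X ^ 3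
    + (388800 * i * eisEval (-24) 1 i
      + 2 * (-t ^ 2 + 72 * t + 11988) * eisEval 240 3 i) * X ^ 2
    - (46656000 * i ^ 2 * eisEval (-24) 1 i
      + 360 * (-t ^ 2 + 72 * t + 11988) * i * eisEval 240 3 i
      - 360 * (t + 18) ^ 2 * eisEval (-504) 5 i) * X
    + (t - 270) * (t + 90) * (t + 18) ^ 2 * eisEval 480 7 i

lemma opInt_cast (t : ℤ) (i : ℕ) (X : ℤ) :
    (opInt t i X : ℂ) = 360 ^ 4 * opCoeff (t / 15) i (X / 360) := by
  simp only [opInt, opCoeff, coeff1, coeff2, coeff3, eisEval_eq]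
  rcases i with _ | i
  · simp only [Nat.beq, cond_true]
    push_cast
    ring
  · simp only [Nat.beq, cond_false]
    push_cast
    norm_num only
    ring

/-- Evaluate an argument before use (relevant for kernel reduction only). -/
def withNat {β : Type} (n : ℕ) (f : ℕ → β) : β :=
  match n with
  | 0 => f 0
  | k + 1 => f (k + 1)

lemma withNat_eq {β : Type} (n : ℕ) (f : ℕ → β) : withNat n f = f n := by cases n <;> rfl

/-- Evaluate an argument before use (relevant for kernel reduction only). -/
def withInt {β : Type} (z : ℤ) (f : ℤ → β) : β :=
  match z with
  | Int.ofNat n => withNat n fun n => f (Int.ofNat n)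
  | Int.negSucc n => withNat n fun n => f (Int.negSucc n)

lemma withInt_eq {β : Type} (z : ℤ) (f : ℤ → β) : withInt z f = f z := by
  cases z <;> simp [withInt, withNat_eq]

/-- Convolution of the symbol with a list of coefficients, most recent first. -/
def convInt (t : ℤ) : List ℤ → ℕ → ℤ → ℤ → ℤ
  | [], _, _, r => r
  | x :: l, i, X, r => withNat i fun i => withInt X fun X =>
      withInt (r + opInt t i X * x) fun r => convInt t l (i + 1) (X - 360) r

/-- Whether the recurrence fails to have a solution in non-negative integers extending `l`. -/
def recurrenceFails (t : ℤ) : ℕ → ℤ → List ℤ → Bool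
  | 0, _, _ => false
  | k + 1, X, l =>
    withInt X fun X => withInt (opInt t 0 X) fun P => withInt (convInt t l 1 (X - 360) 0) fun r =>
    bif P == 0 then !(r == 0) else withInt (r / P) fun v =>
      !(v * P == r) || (decide (0 < v)) || withInt (-v) fun v => recurrenceFails t k (X + 360) (v :: l)

def prefixList (a : ℕ → ℤ) : ℕ → List ℤ
  | 0 => []
  | n + 1 => a n :: prefixList a n

lemma convInt_prefixList (t X₀ : ℤ) (a : ℕ → ℤ) (n : ℕ) : ∀ (i : ℕ) (r : ℤ),
    convInt t (prefixList a (n + 1)) i (X₀ + 360 * n) r =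
      r + ∑ p ∈ Finset.HasAntidiagonal.antidiagonal n,
        opInt t (i + p.1) (X₀ + 360 * p.2) * a p.2 := by
  induction n with
  | zero => intro i r; simp [prefixList, convInt, withNat_eq, withInt_eq]
  | succ n ih =>
    intro i r
    rw [Finset.Nat.sum_antidiagonal_succ, prefixList, convInt, withNat_eq, withInt_eq, withInt_eq,
      show X₀ + 360 * ((n + 1 : ℕ) : ℤ) - 360 = X₀ + 360 * n by push_cast; ring, ih]
    simp only [add_zero, add_assoc]
    congr 2
    exact Finset.sum_congr rfl fun p _ => by rw [add_comm 1 p.1]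

/-- Soundness of the test. With indicial value `P` and convolution `r` of the earlier coefficients,
the next coefficient is `-r / P`, and the test asks that `P` divide `r` and that `r / P` be at most
0. If `P = 0` the next coefficient is free, so only `r = 0` is tested and the search stops. A
genuine non-negative integral solution passes at every depth. -/
lemma recurrenceFails_eq_false {t X₀ : ℤ} {a : ℕ → ℤ} (hpos : ∀ n, 0 ≤ a n)
    (h : ∀ n, ∑ p ∈ Finset.HasAntidiagonal.antidiagonal n,
        opInt t p.1 (X₀ + 360 * p.2) * a p.2 = 0) (k : ℕ) :
    ∀ n : ℕ, recurrenceFails t k (X₀ + 360 * (n + 1 : ℕ)) (prefixList a (n + 1)) = false := by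
  induction k with
  | zero => intro n; rfl
  | succ k ih =>
    intro n
    have hn := h (n + 1)
    rw [Finset.Nat.sum_antidiagonal_succ] at hn
    have hc := convInt_prefixList t X₀ a n 1 0
    simp only [zero_add, add_comm 1] at hc
    rw [← hc] at hn
    simp only [recurrenceFails, withInt_eq]
    rw [show X₀ + 360 * ((n + 1 : ℕ) : ℤ) - 360 = X₀ + 360 * n by push_cast; ring]
    rw [show convInt t (prefixList a (n + 1)) 1 (X₀ + 360 * n) 0 =
      opInt t 0 (X₀ + 360 * (n + 1 : ℕ)) * -a (n + 1) by linarith]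
    generalize hP : opInt t 0 (X₀ + 360 * (n + 1 : ℕ)) = P
    by_cases hP0 : P = 0
    · simp [hP0]
    · have h2 := ih (n + 1)
      rw [prefixList] at h2
      rw [Int.mul_ediv_cancel_left _ hP0, neg_neg]
      rw [show X₀ + 360 * ((n + 1 : ℕ) : ℤ) + 360 = X₀ + 360 * ((n + 1 + 1 : ℕ) : ℤ) by
        push_cast; ring, h2]
      simp [hP0, hpos, mul_comm]

/-- Fifteen times the seventeen parameters of the theorem. -/
def goodParams : List ℤ :=
  [-144, -114, -18, -9, 6, 18, 36, 54, 66, 81, 90, 96, 162, 270, -198, -90, -24]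

/-- The pairs `(15 s, 360 α)` whose solutions are quasimodular of positive depth. -/
def quasiParams : List (ℤ × ℤ) :=
  [(-54, 36), (126, 144), (-234, 216), (-414, 396), (-594, 576), (-954, 936)]

def verdict (t X₀ : ℤ) : Bool :=
  goodParams.contains t || quasiParams.contains (t, X₀) ||
    withInt t fun t => recurrenceFails t 40 (X₀ + 360) [1]

/-- The checks for all divisors of `N` that are at most `m`. -/
def divisorCheck (N : ℕ) (F : ℤ → Bool) : ℕ → Bool
  | 0 => true
  | m + 1 => (bif (N % (m + 1)).beq 0 then F (m + 1 : ℕ) else true) && divisorCheck N F m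

lemma divisorCheck_spec {N : ℕ} {F : ℤ → Bool} {m : ℕ} (h : divisorCheck N F m = true) {d : ℕ}
    (hd : d ∣ N) (h0 : 0 < d) (hm : d ≤ m) : F d = true := by
  induction m with
  | zero => omega
  | succ m ih =>
    rw [divisorCheck, Bool.and_eq_true] at h
    rcases hm.eq_or_lt with rfl | hlt
    · have := h.1
      rw [Nat.mod_eq_zero_of_dvd hd] at this
      exact this
    · exact ih h.2 (by omega)

/-- One of two complementary divisors is at most `√N`, so testing `d` together with `N / d` makes a
search up to `√N` sufficient. -/
lemma divisorCheck_pair_spec {N : ℕ} {F : ℤ → Bool} {m : ℕ}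
    (h : divisorCheck N (fun d => F d && F ((N : ℤ) / d)) m = true) (hN : 0 < N)
    (hm : N < (m + 1) ^ 2) {d : ℕ}
    (hd : d ∣ N) (h0 : 0 < d) : F d = true := by
  obtain ⟨e, rfl⟩ := hd
  by_cases hdm : d ≤ m
  · have := divisorCheck_spec h (dvd_mul_right d e) h0 hdm
    simp only [Bool.and_eq_true] at this
    exact this.1
  · have he : e ≤ m := by
      by_contra hem
      have : (m + 1) * (m + 1) ≤ d * e := Nat.mul_le_mul (by omega) (by omega)
      rw [pow_two] at hm
      omega
    have he0 : 0 < e := Nat.pos_of_mul_pos_left hN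
    have := divisorCheck_spec h (dvd_mul_left e d) he0 he
    simp only [Bool.and_eq_true] at this
    have h3 := this.2
    rwa [Nat.cast_mul, Int.mul_ediv_cancel _ (by exact_mod_cast he0.ne')] at h3

-- In this branch `d = 5 s + 78` and `α = (s + 6) / 24`. The arguments of `verdict` are `15 s` and
-- `360 α` written in terms of `d`. The next three checks do the same for `d = 306 - 15 s`, `5 s +
-- 18` and `42 - 5 s`.
set_option maxRecDepth 10000 in
lemma verdict_of_dvd_4200 : divisorCheck 4200 (fun d => verdict (3 * d - 234) (3 * d - 144) &&
    verdict (3 * (((4200 : ℕ) : ℤ) / d) - 234) (3 * (((4200 : ℕ) : ℤ) / d) - 144)) 64 = true := by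
  decide +kernel

set_option maxRecDepth 10000 in
lemma verdict_of_dvd_100800 : divisorCheck 100800 (fun d => verdict (306 - d) (d - 36) &&
    verdict (306 - ((100800 : ℕ) : ℤ) / d) (((100800 : ℕ) : ℤ) / d - 36)) 317 = true := by
  decide +kernel

set_option maxRecDepth 10000 in
lemma verdict_of_dvd_180 : divisorCheck 180 (fun d => verdict (3 * d - 54) (3 * d - 36) &&
    verdict (3 * (((180 : ℕ) : ℤ) / d) - 54) (3 * (((180 : ℕ) : ℤ) / d) - 36)) 13 = true := by
  decide +kernel

set_option maxRecDepth 10000 in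
lemma verdict_of_dvd_2880 : divisorCheck 2880 (fun d => verdict (126 - 3 * d) (3 * d - 144) &&
    verdict (126 - 3 * (((2880 : ℕ) : ℤ) / d)) (3 * (((2880 : ℕ) : ℤ) / d) - 144)) 53 = true := by
  decide +kernel

/-- A rational root of `z² - b z + N` with `b, N > 0` is a positive divisor of `N`. -/
lemma exists_dvd_of_quadratic {q : ℚ} {b : ℤ} {N : ℕ} (hb : 0 < b) (hN : 0 < N)
    (h : q * (b - q) = N) : ∃ d : ℕ, d ∣ N ∧ 0 < d ∧ q = d := by
  have hint : IsIntegral ℤ q := by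
    refine ⟨Polynomial.X ^ 2 - Polynomial.C b * Polynomial.X + Polynomial.C (N : ℤ), ?_, ?_⟩
    · monicity!
    · simp only [Polynomial.eval₂_add, Polynomial.eval₂_sub, Polynomial.eval₂_mul,
        Polynomial.eval₂_pow, Polynomial.eval₂_C, Polynomial.eval₂_X, algebraMap_int_eq]
      simp only [eq_intCast, Int.cast_natCast]
      linear_combination -h
  obtain ⟨z, rfl⟩ := IsIntegrallyClosed.isIntegral_iff.mp hint
  have hz : z * (b - z) = N := by
    have : ((z * (b - z) : ℤ) : ℚ) = ((N : ℤ) : ℚ) := by push_cast; simpa using h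
    exact_mod_cast this
  have hz0 : 0 < z := by
    by_contra hneg
    nlinarith [mul_nonneg (neg_nonneg.mpr (not_lt.mp hneg)) (sub_nonneg.mpr (by linarith : z ≤ b)),
      (by exact_mod_cast hN : (0 : ℤ) < N)]
  lift z to ℕ using hz0.le
  exact ⟨z, by exact_mod_cast Dvd.intro _ hz, by exact_mod_cast hz0, by simp⟩

/-! ### Reduction to finitely many parameters -/

section CFTType

variable {s : ℂ} {f : ℍ → ℂ} {α : ℚ} {a : ℕ → ℕ}

/-- Conclusion of the arithmetic analysis of the `q`-coefficients. -/
def IsListed (s : ℂ) (α : ℚ) : Prop :=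
  (∃ t ∈ goodParams, s = t / 15) ∨ ∃ p ∈ quasiParams, s = p.1 / 15 ∧ α = p.2 / 360

lemma isListed_of_verdict (hsol : IsSolution s f) (h0 : a 0 = 1)
    (hf : HasQSeries α (fun n => (a n : ℂ)) f) {t X₀ : ℤ} (hs : s = t / 15) (hα : α = X₀ / 360)
    (hv : verdict t X₀ = true) : IsListed s α := by
  have hrec : ∀ n, ∑ p ∈ Finset.HasAntidiagonal.antidiagonal n,
      opInt t p.1 (X₀ + 360 * p.2) * (a p.2 : ℤ) = 0 := fun n => by
    have h := hsol.recurrence hf n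
    have h2 : (360 ^ 4 : ℂ) * ∑ p ∈ Finset.HasAntidiagonal.antidiagonal n,
      opCoeff s p.1 ((α : ℂ) + p.2) * (a p.2 : ℂ) = 0 := by rw [h, mul_zero]
    rw [Finset.mul_sum] at h2
    have h3 : ((∑ p ∈ Finset.HasAntidiagonal.antidiagonal n,
      opInt t p.1 (X₀ + 360 * p.2) * (a p.2 : ℤ) : ℤ) : ℂ) = 0 := by
      rw [← h2, Int.cast_sum]
      refine Finset.sum_congr rfl fun p _ => ?_
      rw [Int.cast_mul, opInt_cast, hs, hα]
      push_cast
      rw [add_div, mul_div_cancel_left₀ _ (by norm_num : (360 : ℂ) ≠ 0)]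
      ring
    exact_mod_cast h3
  have hfalse := recurrenceFails_eq_false (a := fun n => (a n : ℤ)) (fun n => by positivity) hrec
    40 0
  simp only [verdict, withInt_eq, Bool.or_eq_true, List.contains_iff_mem] at hv
  rcases hv with (hv | hv) | hv
  · exact Or.inl ⟨t, hv, hs⟩
  · exact Or.inr ⟨_, hv, hs, hα⟩
  · simp [prefixList, h0] at hfalse
    rw [hfalse] at hv
    exact absurd hv (by simp)

/-- The relation for `n = 0` makes `α` one of the four exponents. The relation for `n = 1` is then a
quadratic equation for an affine function of `s`, with fixed non-zero product of roots and integral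
sum. This leaves only divisors to test. -/
lemma isListed_of_isSolution (hsol : IsSolution s f) (h0 : a 0 = 1)
    (hf : HasQSeries α (fun n => (a n : ℂ)) f) : IsListed s α := by
  have e0 := hsol.recurrence hf 0
  have e1 := hsol.recurrence hf 1
  rw [Finset.Nat.sum_antidiagonal_succ] at e1
  simp only [antidiag_zero, zero_add, h0, opCoeff_zero, Nat.cast_one, mul_one, Nat.cast_zero,
    add_zero, mul_eq_zero] at e0 e1
  have ea : opCoeff s 1 α = 24 * α ^ 3 + (-72 + 240 * coeff1 s) * α ^ 2
      - (-24 + 120 * coeff1 s + 504 * coeff2 s) * α + 480 * coeff3 s := by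
    simp [opCoeff, eisCoeff]
    ring
  rw [ea, coeff1, coeff2, coeff3] at e1
  have hpos : ∀ c : ℕ, 0 < c → (0 : ℤ) < (a 1 : ℤ) + c := fun c hc => by positivity
  rcases e0 with ((h | h) | h) | h
  · have hs : s = ((24 * α - 6 : ℚ) : ℂ) := by push_cast; linear_combination -24 * h
    have hα : (α : ℂ) = (s + 6) / 24 := by linear_combination h
    rw [hα] at e1
    -- The relation for `n = 1` is divisible by `s + 6`. At `s = -6` the number `α + 1` is also an
    -- exponent and `a₁` is unconstrained, but that value is in the list. In the other branches the
    -- values 18, -66/5 and 54/5 play this role.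
    by_cases h6 : s = -6
    · exact Or.inl ⟨-90, by decide, by rw [h6]; norm_num⟩
    -- Up to a constant, `5 s + 78` is the non-cancelled factor of the indicial polynomial at `α +
    -- 1`, that is, of the coefficient of `a₁`.
    have e2 : (5 * s + 78) * ((a 1 + 130) - (5 * s + 78)) = 4200 := by
      have : s + 6 ≠ 0 := fun h => h6 (by linear_combination h)
      apply mul_left_cancel₀ this
      linear_combination 600 * e1
    obtain ⟨d, hd, hd0, hq⟩ := exists_dvd_of_quadratic (q := 5 * (24 * α - 6) + 78)
      (hpos 130 (by norm_num)) (N := 4200) (by norm_num) (by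
        rw [hs] at e2
        exact_mod_cast e2)
    refine isListed_of_verdict hsol h0 hf (t := 3 * d - 234) (X₀ := 3 * d - 144) ?_ ?_
      (divisorCheck_pair_spec verdict_of_dvd_4200 (by norm_num) (by norm_num) hd hd0)
    · rw [hs, show (24 * α - 6 : ℚ) = (d - 78) / 5 by linear_combination hq / 5]
      push_cast
      ring
    · push_cast
      linear_combination hq / 120
  · have hs : s = ((18 - 24 * α : ℚ) : ℂ) := by push_cast; linear_combination 24 * h
    have hα : (α : ℂ) = (18 - s) / 24 := by linear_combination h
    rw [hα] at e1
    by_cases h6 : s = 18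
    · exact Or.inl ⟨270, by decide, by rw [h6]; norm_num⟩
    -- Here the factor `102 - 5 s` is tripled: otherwise the sum of the roots would be `a₁ + 632/3`.
    -- This branch is the reason for the denominator 15 in `s = t / 15`.
    have e2 : (306 - 15 * s) * ((3 * a 1 + 632) - (306 - 15 * s)) = 100800 := by
      have : s - 18 ≠ 0 := fun h => h6 (by linear_combination h)
      apply mul_left_cancel₀ this
      linear_combination (-3600) * e1
    obtain ⟨d, hd, hd0, hq⟩ := exists_dvd_of_quadratic (q := 306 - 15 * (18 - 24 * α))
      (b := 3 * (a 1 : ℤ) + 632) (by positivity) (N := 100800) (by norm_num) (by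
        rw [hs] at e2
        exact_mod_cast e2)
    refine isListed_of_verdict hsol h0 hf (t := 306 - d) (X₀ := d - 36) ?_ ?_
      (divisorCheck_pair_spec (F := fun d => verdict (306 - d) (d - 36)) verdict_of_dvd_100800
        (by norm_num) (by norm_num) hd hd0)
    · rw [hs, show (18 - 24 * α : ℚ) = (306 - d) / 15 by linear_combination -hq / 15]
      push_cast
      ring
    · push_cast
      linear_combination hq / 360
  · have hs : s = ((24 * α - 6 / 5 : ℚ) : ℂ) := by push_cast; linear_combination -24 * h
    have hα : (α : ℂ) = (5 * s + 6) / 120 := by linear_combination h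
    rw [hα] at e1
    by_cases h6 : s = -66 / 5
    · exact Or.inl ⟨-198, by decide, by rw [h6]; norm_num⟩
    have e2 : (5 * s + 18) * ((a 1 + 27) - (5 * s + 18)) = 180 := by
      have : 5 * s + 66 ≠ 0 := fun h => h6 (by linear_combination h / 5)
      apply mul_left_cancel₀ this
      linear_combination 4500 * e1
    obtain ⟨d, hd, hd0, hq⟩ := exists_dvd_of_quadratic (q := 5 * (24 * α - 6 / 5) + 18)
      (hpos 27 (by norm_num)) (N := 180) (by norm_num) (by
        rw [hs] at e2
        exact_mod_cast e2)
    refine isListed_of_verdict hsol h0 hf (t := 3 * d - 54) (X₀ := 3 * d - 36) ?_ ?_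
      (divisorCheck_pair_spec verdict_of_dvd_180 (by norm_num) (by norm_num) hd hd0)
    · rw [hs, show (24 * α - 6 / 5 : ℚ) = (d - 18) / 5 by linear_combination hq / 5]
      push_cast
      ring
    · push_cast
      linear_combination hq / 120
  · have hs : s = ((-24 * α - 6 / 5 : ℚ) : ℂ) := by push_cast; linear_combination 24 * h
    have hα : (α : ℂ) = -(5 * s + 6) / 120 := by linear_combination h
    rw [hα] at e1
    by_cases h6 : s = 54 / 5
    · exact Or.inl ⟨162, by decide, by rw [h6]; norm_num⟩
    have e2 : (42 - 5 * s) * ((a 1 + 108) - (42 - 5 * s)) = 2880 := by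
      have : 5 * s - 54 ≠ 0 := fun h => h6 (by linear_combination h / 5)
      apply mul_left_cancel₀ this
      linear_combination (-18000) * e1
    obtain ⟨d, hd, hd0, hq⟩ := exists_dvd_of_quadratic (q := 42 - 5 * (-24 * α - 6 / 5))
      (hpos 108 (by norm_num)) (N := 2880) (by norm_num) (by
        rw [hs] at e2
        exact_mod_cast e2)
    refine isListed_of_verdict hsol h0 hf (t := 126 - 3 * d) (X₀ := 3 * d - 144) ?_ ?_
      (divisorCheck_pair_spec (F := fun d => verdict (126 - 3 * d) (3 * d - 144))
        verdict_of_dvd_2880 (by norm_num) (by norm_num) hd hd0)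
    · rw [hs, show (-24 * α - 6 / 5 : ℚ) = (42 - d) / 5 by linear_combination -hq / 5]
      push_cast
      ring
    · push_cast
      linear_combination hq / 120

end CFTType

/-! ### The second order equation: Frobenius solutions and their convergence -/

/-- The coefficient of `q^i` in the symbol of `D² - E₂ D + (5/2) D(E₂) + (6/25) E₄`. -/
def kzCoeff (i : ℕ) (x : ℂ) : ℂ :=
  (if i = 0 then x ^ 2 else 0) - eisCoeff (-24) 1 i * x + 5 / 2 * i * eisCoeff (-24) 1 i
    + 6 / 25 * eisCoeff 240 3 i

lemma kzCoeff_zero (x : ℂ) : kzCoeff 0 x = (x - 2 / 5) * (x - 3 / 5) := by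
  simp [kzCoeff, eisCoeff_zero]
  ring

/-- The Frobenius series with leading exponent `β`. -/
def frobenius (β : ℂ) : ℕ → ℂ
  | 0 => 1
  | n + 1 => -(∑ j : Fin (n + 1), kzCoeff (n + 1 - j) (β + (j : ℕ)) * frobenius β j) /
      kzCoeff 0 (β + (n + 1 : ℕ))

lemma frobenius_spec {β : ℂ} (hβ : kzCoeff 0 β = 0) (hne : ∀ n : ℕ, kzCoeff 0 (β + (n + 1 : ℕ)) ≠ 0)
    (n : ℕ) : ∑ p ∈ Finset.HasAntidiagonal.antidiagonal n,
      kzCoeff p.1 (β + p.2) * frobenius β p.2 = 0 := by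
  rw [Finset.Nat.sum_antidiagonal_eq_sum_range_succ
    (fun i j => kzCoeff i (β + j) * frobenius β j), ← Finset.sum_range_reflect]
  have : ∀ j ∈ Finset.range n.succ, kzCoeff (n.succ - 1 - j) (β + ((n - (n.succ - 1 - j) : ℕ) : ℂ)) *
      frobenius β (n - (n.succ - 1 - j)) = kzCoeff (n - j) (β + j) * frobenius β j := fun j hj => by
    have hj' := Finset.mem_range.mp hj
    rw [show n.succ - 1 - j = n - j by omega, show n - (n - j) = j by omega]
  rw [Finset.sum_congr rfl this]
  rcases n with _ | n
  · simp [hβ]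
  · rw [Finset.sum_range_succ, ← Fin.sum_univ_eq_sum_range
      (fun j => kzCoeff (n + 1 - j) (β + j) * frobenius β j)]
    rw [frobenius.eq_2 β n]
    have := hne n
    simp only [Nat.sub_self]
    field_simp
    ring

/-- A sequence with a regular-singular recurrence has radius of convergence at least `1`. -/
lemma exists_le_pow_of_recurrence {a : ℕ → ℂ} {K : ℝ} (hK : 0 ≤ K)
    (h : ∀ n : ℕ, 0 < n → (n : ℝ) * ‖a n‖ ≤ K * ∑ j ∈ Finset.range n, ((n - j : ℕ) : ℝ) ^ 4 * ‖a j‖)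
    {ρ : ℝ} (hρ : 1 < ρ) : ∃ C : ℝ, ∀ n, ‖a n‖ ≤ C * ρ ^ n := by
  have hρ0 : 0 < ρ := by linarith
  have hs : Summable fun i : ℕ => (i : ℝ) ^ 4 * ρ⁻¹ ^ i :=
    summable_pow_mul_geometric_of_norm_lt_one 4 (by
      rw [Real.norm_of_nonneg (by positivity)]
      exact inv_lt_one_of_one_lt₀ hρ)
  -- If `‖a j‖ ≤ C ρ^j` for `j < n`, the right-hand side is at most `K S C ρ^n`, and this is at most
  -- `n C ρ^n` once `n ≥ K S`. The constant `C` is chosen to cover the finitely many smaller `n`.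
  set S := ∑' i : ℕ, (i : ℝ) ^ 4 * ρ⁻¹ ^ i
  obtain ⟨N, hN⟩ := exists_nat_ge (K * S)
  set C := ∑ j ∈ Finset.range (N + 1), ‖a j‖ * ρ⁻¹ ^ j
  have hC0 : 0 ≤ C := Finset.sum_nonneg fun j _ => by positivity
  refine ⟨C, fun n => ?_⟩
  induction n using Nat.strong_induction_on with | _ n ih =>
  by_cases hn : n ≤ N
  · have h1 : ‖a n‖ * ρ⁻¹ ^ n ≤ C := Finset.single_le_sum (f := fun j => ‖a j‖ * ρ⁻¹ ^ j)
      (fun j _ => by positivity) (Finset.mem_range.mpr (by omega))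
    rw [inv_pow] at h1
    exact (mul_inv_le_iff₀ (by positivity)).mp h1
  · have hn0 : (0 : ℝ) < n := by exact_mod_cast (by omega : 0 < n)
    have h1 : ∑ j ∈ Finset.range n, ((n - j : ℕ) : ℝ) ^ 4 * ‖a j‖ ≤ C * ρ ^ n * S := by
      calc _ ≤ ∑ j ∈ Finset.range n, C * ρ ^ n * (((n - j : ℕ) : ℝ) ^ 4 * ρ⁻¹ ^ (n - j)) := by
            refine Finset.sum_le_sum fun j hj => ?_
            have hj' := Finset.mem_range.mp hj
            have : ρ ^ n * ρ⁻¹ ^ (n - j) = ρ ^ j := by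
              rw [inv_pow, ← div_eq_mul_inv, div_eq_iff (by positivity), ← pow_add]
              congr 1
              omega
            calc ((n - j : ℕ) : ℝ) ^ 4 * ‖a j‖ ≤ ((n - j : ℕ) : ℝ) ^ 4 * (C * ρ ^ j) := by
                  gcongr
                  exact ih j hj'
              _ = _ := by rw [← this]; ring
        _ = C * ρ ^ n * ∑ j ∈ Finset.range n, (((n - j : ℕ) : ℝ) ^ 4 * ρ⁻¹ ^ (n - j)) := by
            rw [Finset.mul_sum]
        _ ≤ C * ρ ^ n * S := by
            gcongr
            rw [← Finset.sum_range_reflect]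
            calc _ = ∑ j ∈ Finset.range n, (((j + 1 : ℕ) : ℝ) ^ 4 * ρ⁻¹ ^ (j + 1)) := by
                  refine Finset.sum_congr rfl fun j hj => ?_
                  have hj' := Finset.mem_range.mp hj
                  rw [show n - (n - 1 - j) = j + 1 by omega]
              _ ≤ ∑ j ∈ Finset.range (n + 1), ((j : ℝ) ^ 4 * ρ⁻¹ ^ j) := by
                  rw [Finset.sum_range_succ' _ n]
                  simp
              _ ≤ S := hs.sum_le_tsum _ fun j _ => by positivity
    have h2 := h n (by omega)
    have h3 : (n : ℝ) * ‖a n‖ ≤ n * (C * ρ ^ n) := by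
      calc (n : ℝ) * ‖a n‖ ≤ K * (C * ρ ^ n * S) := h2.trans (by gcongr)
        _ = (K * S) * (C * ρ ^ n) := by ring
        _ ≤ n * (C * ρ ^ n) := by
            gcongr
            exact hN.trans (by exact_mod_cast (by omega : N ≤ n))
    exact le_of_mul_le_mul_left h3 hn0

lemma exists_hasQSeries_of_growth {a : ℕ → ℂ} (β : ℚ)
    (h : ∀ ρ : ℝ, 1 < ρ → ∃ C : ℝ, ∀ n, ‖a n‖ ≤ C * ρ ^ n) : ∃ f, HasQSeries β a f := by
  refine ⟨fun τ => ∑' n, a n * Complex.exp (2 * Real.pi * Complex.I * ((β : ℂ) + (n : ℂ)) * τ),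
    fun τ => Summable.hasSum ?_⟩
  set q := Complex.exp (2 * Real.pi * Complex.I * τ)
  have hq : ‖q‖ < 1 := UpperHalfPlane.norm_exp_two_pi_I_lt_one τ
  have hq0 : 0 < ‖q‖ := norm_pos_iff.mpr (Complex.exp_ne_zero _)
  obtain ⟨r, hr1, hr2⟩ := exists_between hq
  have hr0 : 0 < r := hq0.trans hr1
  obtain ⟨C, hC⟩ := h r⁻¹ ((one_lt_inv₀ hr0).mpr hr2)
  have hs : Summable fun n : ℕ => a n * q ^ n := by
    refine Summable.of_norm_bounded (g := fun n => C * (r⁻¹ * ‖q‖) ^ n)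
      ((summable_geometric_of_lt_one (by positivity) ?_).mul_left C) fun n => ?_
    · rw [inv_mul_lt_iff₀ hr0, mul_one]
      exact hr1
    · rw [norm_mul, norm_pow, mul_pow, ← mul_assoc]
      gcongr
      exact hC n
  refine (hs.mul_left (Complex.exp (2 * Real.pi * Complex.I * β * τ))).congr fun n => ?_
  rw [cexp_qpow_add]
  ring

/-- The three terms contribute 24, 60 and 288/5, with sum below 142, after `σ₁(i) ≤ i²` and `σ₃(i) ≤
i⁴`. -/
lemma norm_kzCoeff_le {i : ℕ} (hi : 0 < i) {x : ℂ} {N : ℝ} (hN : 1 ≤ N) (hx : ‖x‖ ≤ N) :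
    ‖kzCoeff i x‖ ≤ 142 * (i : ℝ) ^ 4 * N := by
  have h1 : (ArithmeticFunction.sigma 1 i : ℝ) ≤ (i : ℝ) ^ 2 := by
    exact_mod_cast ArithmeticFunction.sigma_le_pow_succ 1 i
  have h3 : (ArithmeticFunction.sigma 3 i : ℝ) ≤ (i : ℝ) ^ 4 := by
    exact_mod_cast ArithmeticFunction.sigma_le_pow_succ 3 i
  have hi1 : (1 : ℝ) ≤ i := by exact_mod_cast hi
  have e : kzCoeff i x = (24 * ArithmeticFunction.sigma 1 i * x +
      -(60 * i * ArithmeticFunction.sigma 1 i)) + 288 / 5 * ArithmeticFunction.sigma 3 i := by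
    simp only [kzCoeff, eisCoeff, if_neg hi.ne']
    push_cast
    ring
  rw [e]
  refine (norm_add₃_le).trans ?_
  simp only [norm_mul, norm_neg, Complex.norm_natCast, Complex.norm_ofNat, norm_div]
  have hi24 : (i : ℝ) ^ 2 ≤ (i : ℝ) ^ 4 := pow_le_pow_right₀ hi1 (by norm_num)
  have hi34 : (i : ℝ) ^ 3 ≤ (i : ℝ) ^ 4 := pow_le_pow_right₀ hi1 (by norm_num)
  have t1 : (ArithmeticFunction.sigma 1 i : ℝ) * ‖x‖ ≤ (i : ℝ) ^ 4 * N := by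
    gcongr
    exact h1.trans hi24
  have t2 : (i : ℝ) * (ArithmeticFunction.sigma 1 i : ℝ) ≤ (i : ℝ) ^ 4 * N := by
    calc (i : ℝ) * (ArithmeticFunction.sigma 1 i : ℝ) ≤ i * (i : ℝ) ^ 2 := by gcongr
      _ = (i : ℝ) ^ 3 * 1 := by ring
      _ ≤ _ := by gcongr
  have t3 : (ArithmeticFunction.sigma 3 i : ℝ) ≤ (i : ℝ) ^ 4 * N := by
    calc (ArithmeticFunction.sigma 3 i : ℝ) ≤ (i : ℝ) ^ 4 * 1 := by linarith
      _ ≤ _ := by gcongr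
  have t0 : (0 : ℝ) ≤ (i : ℝ) ^ 4 * N := by positivity
  nlinarith

/-- `u` solves the second order equation, in the form of a first order system with respect to the
Serre derivative. -/
structure IsSerrePair (u w : ℍ → ℂ) : Prop where
  left : HasD u (fun τ => w τ + 5 / 12 * eis2 τ * u τ)
  right : HasD w (fun τ => 11 / 3600 * eis4 τ * u τ + 7 / 12 * eis2 τ * w τ)

/-- The exponents differ by 1/5, so the Frobenius recurrence meets no resonance. Its growth is
controlled by `exists_le_pow_of_recurrence`, and `w` is the weight 5 Serre derivative of `u`. -/
lemma exists_isSerrePair {β : ℚ} (hβ : β = 2 / 5 ∨ β = 3 / 5) :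
    ∃ (a : ℕ → ℂ) (u w : ℍ → ℂ), a 0 = 1 ∧ HasQSeries β a u ∧ IsSerrePair u w := by
  have hβ1 : (2 / 5 : ℝ) ≤ β := by rcases hβ with rfl | rfl <;> norm_num
  have hβ2 : (β : ℝ) ≤ 1 := by rcases hβ with rfl | rfl <;> norm_num
  have h0 : kzCoeff 0 (β : ℂ) = 0 := by
    rw [kzCoeff_zero]
    rcases hβ with rfl | rfl <;> norm_num
  -- The indicial value at `β + k` is `k (k + 2β - 1)` with `2β - 1 = ∓1/5`, hence at least `(4/5)
  -- k²` for `k ≥ 1`. Below, `355/2` is `142 · 5/4`.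
  have hlow : ∀ n : ℕ, 4 / 5 * ((n + 1 : ℕ) : ℝ) ^ 2 ≤ ‖kzCoeff 0 ((β : ℂ) + (n + 1 : ℕ))‖ := by
    intro n
    have e : kzCoeff 0 ((β : ℂ) + (n + 1 : ℕ)) =
        (((n + 1 : ℕ) * ((n + 1 : ℕ) + (2 * β - 1)) : ℝ) : ℂ) := by
      rw [kzCoeff_zero]
      rcases hβ with rfl | rfl <;> push_cast <;> ring
    rw [e, Complex.norm_real]
    refine le_trans ?_ (le_abs_self _)
    have : (1 : ℝ) ≤ (n + 1 : ℕ) := by exact_mod_cast Nat.succ_le_succ (Nat.zero_le n)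
    nlinarith
  have hne : ∀ n : ℕ, kzCoeff 0 ((β : ℂ) + (n + 1 : ℕ)) ≠ 0 := fun n h => by
    have := hlow n
    rw [h, norm_zero] at this
    have : (0 : ℝ) < 4 / 5 * ((n + 1 : ℕ) : ℝ) ^ 2 := by positivity
    linarith
  have hspec := frobenius_spec h0 hne
  have hgrow : ∀ n : ℕ, 0 < n → (n : ℝ) * ‖frobenius β n‖ ≤
      (355 / 2) * ∑ j ∈ Finset.range n, ((n - j : ℕ) : ℝ) ^ 4 * ‖frobenius β j‖ := by
    rintro (_ | n) hn
    · omega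
    have e : kzCoeff 0 ((β : ℂ) + (n + 1 : ℕ)) * frobenius β (n + 1) =
        -(∑ j ∈ Finset.range (n + 1), kzCoeff (n + 1 - j) (β + j) * frobenius β j) := by
      rw [frobenius.eq_2, mul_div_cancel₀ _ (hne n), ← Fin.sum_univ_eq_sum_range
        (fun j => kzCoeff (n + 1 - j) (β + j) * frobenius β j)]
    have hle : ‖kzCoeff 0 ((β : ℂ) + (n + 1 : ℕ)) * frobenius β (n + 1)‖ ≤
        ∑ j ∈ Finset.range (n + 1), 142 * (n + 1 : ℕ) *
          (((n + 1 - j : ℕ) : ℝ) ^ 4 * ‖frobenius β j‖) := by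
      rw [e, norm_neg]
      refine (norm_sum_le _ _).trans (Finset.sum_le_sum fun j hj => ?_)
      have hj' := Finset.mem_range.mp hj
      rw [norm_mul]
      have := norm_kzCoeff_le (i := n + 1 - j) (x := β + j) (N := (n + 1 : ℕ)) (by omega)
        (by exact_mod_cast hn) (by
          have hx : ((β : ℂ) + j) = (((β : ℝ) + j : ℝ) : ℂ) := by push_cast; rfl
          rw [hx, Complex.norm_real, Real.norm_of_nonneg (by positivity)]
          have : (j : ℝ) ≤ n := by exact_mod_cast (by omega : j ≤ n)
          push_cast
          linarith)
      calc _ ≤ 142 * ((n + 1 - j : ℕ) : ℝ) ^ 4 * (n + 1 : ℕ) * ‖frobenius β j‖ := by gcongr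
        _ = _ := by ring
    rw [norm_mul, ← Finset.mul_sum] at hle
    have h3 := (mul_le_mul_of_nonneg_right (hlow n) (norm_nonneg (frobenius β (n + 1)))).trans hle
    have hn0 : (0 : ℝ) < (n + 1 : ℕ) := by positivity
    refine le_of_mul_le_mul_left ?_ hn0
    linarith [h3]
  obtain ⟨u, hu⟩ := exists_hasQSeries_of_growth β
    fun ρ hρ => exists_le_pow_of_recurrence (by norm_num) hgrow hρ
  have hu1 := hu.deriv
  have hu2 := hu1.deriv
  have m0 : ∀ {c b : ℕ → ℂ} {x v : ℍ → ℂ}, HasQSeries 0 c x → HasQSeries β b v →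
      HasQSeries β (fun n => ∑ p ∈ Finset.HasAntidiagonal.antidiagonal n, c p.1 * b p.2)
        (fun τ => x τ * v τ) := fun hx hv =>
    (hx.mul hv).of_eq (zero_add β) (fun _ => rfl) (fun _ => rfl)
  have H := ((hu2.sub (m0 hasQSeries_eis2 hu1)).add (m0 ((hasQSeries_eis2.deriv.const_mul (5 / 2)).add
    (hasQSeries_eis4.const_mul (6 / 25))) hu)).eq_zero_of_coeff (fun n => by
      rw [← hspec n, ← sum_antidiagonal_ite_zero n (fun n => ((β : ℂ) + n) * (((β : ℂ) + n) *
        frobenius β n)), ← Finset.sum_sub_distrib, ← Finset.sum_add_distrib]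
      refine Finset.sum_congr rfl fun p _ => ?_
      simp only [kzCoeff]
      split_ifs with hp
      · simp only [hp]; push_cast; ring
      · push_cast; ring)
  refine ⟨frobenius β, u, fun τ => qD u τ - 5 / 12 * (eis2 τ * u τ), frobenius.eq_1 _, hu, ?_, ?_⟩
  · exact (HasD.self hu.mdiff).congr (fun _ => rfl) fun τ => by ring
  · refine ((HasD.self hu1.mdiff).sub ((hasD_eis2.mul (HasD.self hu.mdiff)).const_mul
      (5 / 12))).congr (fun _ => rfl) fun τ => ?_
    have h := congrFun H τ
    simp only [Pi.zero_apply, hasD_eis2.deriv] at h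
    linear_combination h

/-! ### The odd part of the Weil representation of `SL₂(𝔽₅)` -/

/-- A formal integral combination of fifth roots of unity. -/
abbrev RootSum := List (ℤ × ZMod 5)

namespace RootSum

def eval (t : ℂ) (l : RootSum) : ℂ := (l.map fun p => (p.1 : ℂ) * t ^ p.2.val).sum

def mul (l m : RootSum) : RootSum := l.flatMap fun p => m.map fun q => (p.1 * q.1, p.2 + q.2)

def coeff (i : ZMod 5) (l : RootSum) : ℤ := (l.map fun p => if p.2 = i then p.1 else 0).sum

variable {t : ℂ}

lemma eval_append (l m : RootSum) : eval t (l ++ m) = eval t l + eval t m := by simp [eval]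

lemma pow_val_add (ht : t ^ 5 = 1) (x y : ZMod 5) : t ^ (x + y).val = t ^ x.val * t ^ y.val := by
  rw [ZMod.val_add, ← pow_add]
  conv_rhs => rw [← Nat.mod_add_div (x.val + y.val) 5, pow_add, pow_mul, ht, one_pow, mul_one]

lemma eval_map_mul (ht : t ^ 5 = 1) (p : ℤ × ZMod 5) (m : RootSum) :
    eval t (m.map fun q => (p.1 * q.1, p.2 + q.2)) = (p.1 : ℂ) * t ^ p.2.val * eval t m := by
  induction m with
  | nil => simp [eval]
  | cons q m ih =>
    simp only [eval, List.map_cons, List.sum_cons, pow_val_add ht] at ih ⊢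
    rw [ih]
    push_cast
    ring

lemma eval_mul (ht : t ^ 5 = 1) (l m : RootSum) : eval t (mul l m) = eval t l * eval t m := by
  induction l with
  | nil => simp [mul, eval]
  | cons p l ih =>
    have e : mul (p :: l) m = (m.map fun q => (p.1 * q.1, p.2 + q.2)) ++ mul l m := by
      simp [mul]
    rw [e, eval_append, ih, eval_map_mul ht]
    simp only [eval, List.map_cons, List.sum_cons]
    ring

lemma eval_eq_sum (l : RootSum) : eval t l = ∑ i : ZMod 5, (coeff i l : ℂ) * t ^ i.val := by
  induction l with
  | nil => simp [eval, coeff]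
  | cons p l ih =>
    have : ∀ i, (coeff i (p :: l) : ℂ) = (if p.2 = i then (p.1 : ℂ) else 0) + coeff i l := by
      intro i
      simp [coeff]
    simp only [this, add_mul, Finset.sum_add_distrib, ← ih, ite_mul, zero_mul,
      Finset.sum_ite_eq, Finset.mem_univ, if_true]
    simp [eval]

/-- Equality is needed only modulo the relation `1 + t + t² + t³ + t⁴ = 0`, so it suffices that all
coefficients of the difference coincide. This is a decidable criterion. -/
lemma eval_eq_of_coeff (ht : 1 + t + t ^ 2 + t ^ 3 + t ^ 4 = 0) {l m : RootSum}
    (h : ∀ i, coeff i l - coeff i m = coeff 0 l - coeff 0 m) : eval t l = eval t m := by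
  have hs : ∑ i : ZMod 5, t ^ i.val = 0 := by
    rw [← ht]
    change ∑ i : Fin 5, t ^ i.val = _
    simp [Fin.sum_univ_five]
  rw [← sub_eq_zero, eval_eq_sum, eval_eq_sum, ← Finset.sum_sub_distrib]
  have : ∀ i : ZMod 5, (coeff i l : ℂ) * t ^ i.val - (coeff i m : ℂ) * t ^ i.val =
      ((coeff 0 l - coeff 0 m : ℤ) : ℂ) * t ^ i.val := fun i => by
    rw [← h i]
    push_cast
    ring
  rw [Finset.sum_congr rfl fun i _ => this i, ← Finset.mul_sum, hs, mul_zero]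

end RootSum

open RootSum

/-- The Gauss sum `t + t⁴ - t² - t³`. -/
def gaussSum5 : RootSum := [(1, 1), (1, 4), (-1, 2), (-1, 3)]

/-- The value at 0 is immaterial: for matrices of determinant one, `weilEntry` evaluates it only at
units. -/
def legendre5 (x : ZMod 5) : ℤ := if x = 1 ∨ x = 4 then 1 else -1

def weilIndex (i : Fin 2) : ZMod 5 := if i = 0 then 1 else 2

/-- Entries of the odd part of the Weil representation of `SL₂(𝔽₅)`, times the Gauss sum. -/
def weilEntry (a b c d : ZMod 5) (i j : Fin 2) : RootSum :=
  if c = 0 then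
    mul gaussSum5 [(legendre5 a * ((if weilIndex j = a * weilIndex i then 1 else 0) -
      (if weilIndex j = -a * weilIndex i then 1 else 0)), a * b * weilIndex i ^ 2)]
  else
    [(legendre5 c, (a * weilIndex i ^ 2 - 2 * weilIndex i * weilIndex j + d * weilIndex j ^ 2) * c ^ 3),
      (-legendre5 c,
        (a * weilIndex i ^ 2 + 2 * weilIndex i * weilIndex j + d * weilIndex j ^ 2) * c ^ 3)]

-- Multiplicativity under right multiplication by `S`, as a finite check. Every entry carries a
-- factor of the Gauss sum, so a product of two entries carries two; this explains the extra
-- `gaussSum5` on the other side. Coefficients are compared relative to the zeroth one, as required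
-- by `eval_eq_of_coeff`.
set_option maxRecDepth 10000 in
lemma weilEntry_S : ∀ a b c d : ZMod 5, a * d - b * c = 1 → ∀ i j : Fin 2, ∀ k : ZMod 5,
    coeff k (mul gaussSum5 (weilEntry b (-a) d (-c) i j)) -
      coeff k (mul (weilEntry a b c d i 0) (weilEntry 0 (-1) 1 0 0 j) ++
        mul (weilEntry a b c d i 1) (weilEntry 0 (-1) 1 0 1 j)) =
    coeff 0 (mul gaussSum5 (weilEntry b (-a) d (-c) i j)) -
      coeff 0 (mul (weilEntry a b c d i 0) (weilEntry 0 (-1) 1 0 0 j) ++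
        mul (weilEntry a b c d i 1) (weilEntry 0 (-1) 1 0 1 j)) := by
  decide +kernel

set_option maxRecDepth 10000 in
lemma weilEntry_T : ∀ a b c d : ZMod 5, a * d - b * c = 1 → ∀ i j : Fin 2, ∀ k : ZMod 5,
    coeff k (weilEntry a (a + b) c (c + d) i j) -
      coeff k (mul (weilEntry a b c d i j) [(1, weilIndex j ^ 2)]) =
    coeff 0 (weilEntry a (a + b) c (c + d) i j) -
      coeff 0 (mul (weilEntry a b c d i j) [(1, weilIndex j ^ 2)]) := by
  decide +kernel

/-! ### The solution space of the second order equation -/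

lemma HasD.exists_eq_const {f : ℍ → ℂ} (h : HasD f fun _ => 0) : ∃ c, ∀ τ, f τ = c := by
  have hm := h.mdiff
  rw [UpperHalfPlane.mdifferentiable_iff] at hm
  have hpre : IsPreconnected UpperHalfPlane.upperHalfPlaneSet :=
    (convex_halfSpace_im_gt 0).isPreconnected
  obtain ⟨c, hc⟩ := isOpen_upperHalfPlaneSet.exists_is_const_of_deriv_eq_zero hpre hm
    (fun z hz => by
      have := h.deriv ⟨z, hz⟩
      rw [qD, Derivative.normalizedDerivOfComplex] at this
      exact (mul_eq_zero.mp this).resolve_left (inv_ne_zero Complex.two_pi_I_ne_zero))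
  refine ⟨c, fun τ => ?_⟩
  have := hc _ τ.2
  simpa using! this

/-- The Serre derivative commutes with the slash action. -/
lemma HasD.slash {f g : ℍ → ℂ} {k : ℤ} (h : HasD f fun τ => g τ + k / 12 * eis2 τ * f τ)
    (γ : SL(2, ℤ)) : HasD (f ∣[k] γ)
      fun τ => (g ∣[k + 2] γ) τ + k / 12 * eis2 τ * (f ∣[k] γ) τ := by
  refine ⟨h.mdiff.slash k _, fun τ => ?_⟩
  have h1 := congrFun (Derivative.normalizedDerivOfComplex_SL_slash (k := k) (γ := γ) h.mdiff) τ
  have e : Derivative.normalizedDerivOfComplex f = fun τ => g τ + k / 12 * (f τ * eis2 τ) := by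
    rw [show Derivative.normalizedDerivOfComplex f = _ from h.qD_eq]
    funext τ
    ring
  rw [e, add_slash_fun, smul_slash_fun, mul_slash_fun k 2] at h1
  simp only [Pi.sub_apply, slash_eis2] at h1
  rw [qD, h1]
  ring

namespace IsSerrePair

variable {u w v z : ℍ → ℂ}

lemma slash (h : IsSerrePair u w) (γ : SL(2, ℤ)) :
    IsSerrePair (u ∣[(5 : ℤ)] γ) (w ∣[(7 : ℤ)] γ) := by
  constructor
  · have := HasD.slash (k := 5) (g := w) (h.left.congr (fun _ => rfl) fun τ => by push_cast; ring) γ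
    exact this.congr (fun _ => rfl) fun τ => by push_cast; rfl
  · have := HasD.slash (k := 7) (f := w) (g := fun τ => (11 / 3600) * (eis4 τ * u τ))
      (h.right.congr (fun _ => rfl) fun τ => by push_cast; ring) γ
    refine this.congr (fun _ => rfl) fun τ => ?_
    rw [smul_slash_fun]
    have e := mul_slash_fun 4 5 γ eis4 u
    norm_num only at e ⊢
    rw [e, slash_eis4]
    push_cast
    ring

lemma add (h : IsSerrePair u w) (h' : IsSerrePair v z) :
    IsSerrePair (fun τ => u τ + v τ) (fun τ => w τ + z τ) :=
  ⟨(h.left.add h'.left).congr (fun _ => rfl) fun τ => by ring,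
    (h.right.add h'.right).congr (fun _ => rfl) fun τ => by ring⟩

lemma const_mul (c : ℂ) (h : IsSerrePair u w) :
    IsSerrePair (fun τ => c * u τ) (fun τ => c * w τ) :=
  ⟨(h.left.const_mul c).congr (fun _ => rfl) fun τ => by ring,
    (h.right.const_mul c).congr (fun _ => rfl) fun τ => by ring⟩

lemma right_unique (h : IsSerrePair u w) (h' : IsSerrePair u z) : w = z :=
  funext fun τ => by
    have := (h.left.deriv τ).symm.trans (h'.left.deriv τ)
    linear_combination this

/-- The Wronskian has weight 12 and is killed by the Serre derivative, because the first order
system has trace zero. The same holds for `η²⁴`, so the quotient is constant. -/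
lemma exists_wronskian (h : IsSerrePair u w) (h' : IsSerrePair v z) :
    ∃ c, ∀ τ, u τ * z τ - v τ * w τ = c * eta12 τ ^ 2 := by
  have hne : ∀ τ, eta12 τ ^ 2 ≠ 0 := fun τ => pow_ne_zero _ (eta12_ne_zero τ)
  obtain ⟨c, hc⟩ := (((h.left.mul h'.right).sub (h'.left.mul h.right)).mul
    (hasD_inv (hasD_eta12.pow 2) hne)).congr (fun _ => rfl) (fun τ => by
      have := hne τ
      have := eta12_ne_zero τ
      field_simp
      push_cast
      ring) |>.exists_eq_const
  exact ⟨c, fun τ => by rw [← hc τ, inv_mul_cancel_right₀ (hne τ)]⟩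

/-- Two independent solutions span all solutions. -/
lemma exists_linear_combination {c : ℂ} (hc : c ≠ 0) {u₀ w₀ u₁ w₁ : ℍ → ℂ}
    (h₀ : IsSerrePair u₀ w₀) (h₁ : IsSerrePair u₁ w₁)
    (hW : ∀ τ, u₀ τ * w₁ τ - u₁ τ * w₀ τ = c * eta12 τ ^ 2) (h : IsSerrePair u w) :
    ∃ x y : ℂ, u = fun τ => x * u₀ τ + y * u₁ τ := by
  obtain ⟨x, hx⟩ := h.exists_wronskian h₁
  obtain ⟨y, hy⟩ := h₀.exists_wronskian h
  -- Cramer's rule: the coordinates are quotients of Wronskians, which are constant.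
  refine ⟨x / c, y / c, funext fun τ => ?_⟩
  have hne : c * eta12 τ ^ 2 ≠ 0 := mul_ne_zero hc (pow_ne_zero _ (eta12_ne_zero τ))
  refine mul_right_cancel₀ hne ?_
  rw [← hW τ]
  have h1 := hx τ
  have h2 := hy τ
  have h3 := hW τ
  have e : x / c * u₀ τ * (c * eta12 τ ^ 2) = x * eta12 τ ^ 2 * u₀ τ := by field_simp
  have e' : y / c * u₁ τ * (c * eta12 τ ^ 2) = y * eta12 τ ^ 2 * u₁ τ := by field_simp
  rw [add_mul, h3, e, e', ← h1, ← h2, ← h3]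
  ring

lemma coeff_eq_zero {c : ℂ} (hc : c ≠ 0) {u₀ w₀ u₁ w₁ : ℍ → ℂ}
    (h₀ : IsSerrePair u₀ w₀) (h₁ : IsSerrePair u₁ w₁)
    (hW : ∀ τ, u₀ τ * w₁ τ - u₁ τ * w₀ τ = c * eta12 τ ^ 2) {x y : ℂ}
    (h : ∀ τ, x * u₀ τ + y * u₁ τ = 0) : x = 0 ∧ y = 0 := by
  have hp : IsSerrePair (fun _ => 0) (fun τ => x * w₀ τ + y * w₁ τ) := by
    have := (h₀.const_mul x).add (h₁.const_mul y)
    simpa only [h] using this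
  have hz : IsSerrePair (fun _ => 0) (fun _ => 0) :=
    ⟨(HasD.const 0).congr (fun _ => rfl) fun τ => by ring,
      (HasD.const 0).congr (fun _ => rfl) fun τ => by ring⟩
  have h' := fun τ => congrFun (hp.right_unique hz) τ
  have hne : c * eta12 I ^ 2 ≠ 0 := mul_ne_zero hc (pow_ne_zero _ (eta12_ne_zero I))
  constructor <;> refine (mul_eq_zero.mp ?_).resolve_right hne <;> rw [← hW I]
  · linear_combination w₁ I * h I - u₁ I * h' I
  · linear_combination -w₀ I * h I + u₀ I * h' I

end IsSerrePair

lemma slash_neg_one {k : ℤ} (hk : Odd k) (f : ℍ → ℂ) : f ∣[k] (-1 : SL(2, ℤ)) = fun τ => -f τ := by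
  funext τ
  rw [ModularForm.SL_slash_apply, ModularGroup.SL_neg_smul, one_smul]
  have : denom (-1 : SL(2, ℤ)) τ = -1 := by
    rw [ModularGroup.denom_apply]; simp
  rw [this, hk.neg.neg_one_zpow]
  ring

/-! ### The action of `S` on a normalised basis -/

open RootSum

/-- The primitive fifth root of unity `exp (4πi/5)`. -/
def zeta5 : ℂ := Complex.exp (2 * Real.pi * Complex.I * ((2 / 5 : ℚ) : ℂ))

lemma zeta5_pow : zeta5 ^ 5 = 1 := by
  rw [zeta5, ← Complex.exp_nat_mul, Complex.exp_eq_one_iff]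
  exact ⟨2, by push_cast; ring⟩

lemma zeta5_ne_one : zeta5 ≠ 1 := by
  intro h
  rw [zeta5, Complex.exp_eq_one_iff] at h
  obtain ⟨n, hn⟩ := h
  have h2 : ((2 / 5 : ℚ) : ℂ) = n := by
    refine mul_left_cancel₀ Complex.two_pi_I_ne_zero ?_
    rw [hn]
    ring
  have h3 : (2 : ℤ) = 5 * n := by
    have : (2 : ℂ) = 5 * n := by rw [← h2]; push_cast; norm_num
    exact_mod_cast this
  omega

lemma zeta5_sum : 1 + zeta5 + zeta5 ^ 2 + zeta5 ^ 3 + zeta5 ^ 4 = 0 := by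
  have := sub_ne_zero.mpr zeta5_ne_one
  refine (mul_eq_zero.mp ?_).resolve_left this
  linear_combination zeta5_pow

lemma zeta5_ne_zero : zeta5 ≠ 0 := Complex.exp_ne_zero _

lemma exp_three_fifths : Complex.exp (2 * Real.pi * Complex.I * ((3 / 5 : ℚ) : ℂ)) = zeta5 ^ 4 := by
  rw [zeta5, ← Complex.exp_nat_mul, Complex.exp_eq_exp_iff_exists_int]
  exact ⟨-1, by push_cast; ring⟩

lemma eval_gaussSum5 (t : ℂ) : eval t gaussSum5 = t + t ^ 4 - t ^ 2 - t ^ 3 := by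
  have h1 : (1 : ZMod 5).val = 1 := rfl
  have h2 : (2 : ZMod 5).val = 2 := rfl
  have h3 : (3 : ZMod 5).val = 3 := rfl
  have h4 : (4 : ZMod 5).val = 4 := rfl
  simp only [eval, gaussSum5, List.map_cons, List.map_nil, List.sum_cons, List.sum_nil, h1, h2, h3,
    h4]
  push_cast
  ring

lemma gaussSum5_sq {t : ℂ} (h : 1 + t + t ^ 2 + t ^ 3 + t ^ 4 = 0) :
    (t + t ^ 4 - t ^ 2 - t ^ 3) ^ 2 = 5 := by
  linear_combination (-5 + 5 * t + t ^ 2 - 3 * t ^ 3 + t ^ 4) * h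

lemma weilEntry_S_values :
    weilEntry 0 (-1) 1 0 0 0 = [(1, 3), (-1, 2)] ∧ weilEntry 0 (-1) 1 0 0 1 = [(1, 1), (-1, 4)] ∧
    weilEntry 0 (-1) 1 0 1 0 = [(1, 1), (-1, 4)] ∧ weilEntry 0 (-1) 1 0 1 1 = [(1, 2), (-1, 3)] := by
  decide

/-- The matrix entries of the odd part of the Weil representation. -/
def weilMatrix (γ : SL(2, ℤ)) (i j : Fin 2) : ℂ :=
  (eval zeta5 gaussSum5)⁻¹ * eval zeta5 (weilEntry (γ 0 0) (γ 0 1) (γ 1 0) (γ 1 1) i j)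

lemma eval_gaussSum5_ne_zero : eval zeta5 gaussSum5 ≠ 0 := by
  rw [eval_gaussSum5]
  intro h
  have := gaussSum5_sq zeta5_sum
  rw [h] at this
  norm_num at this

lemma weilMatrix_S_values :
    weilMatrix ModularGroup.S 0 0 = (eval zeta5 gaussSum5)⁻¹ * (zeta5 ^ 3 - zeta5 ^ 2) ∧
    weilMatrix ModularGroup.S 0 1 = (eval zeta5 gaussSum5)⁻¹ * (zeta5 - zeta5 ^ 4) ∧
    weilMatrix ModularGroup.S 1 0 = (eval zeta5 gaussSum5)⁻¹ * (zeta5 - zeta5 ^ 4) ∧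
    weilMatrix ModularGroup.S 1 1 = -((eval zeta5 gaussSum5)⁻¹ * (zeta5 ^ 3 - zeta5 ^ 2)) := by
  have h1 : (1 : ZMod 5).val = 1 := rfl
  have h2 : (2 : ZMod 5).val = 2 := rfl
  have h3 : (3 : ZMod 5).val = 3 := rfl
  have h4 : (4 : ZMod 5).val = 4 := rfl
  obtain ⟨e1, e2, e3, e4⟩ := weilEntry_S_values
  have e (i j) : weilMatrix ModularGroup.S i j =
      (eval zeta5 gaussSum5)⁻¹ * eval zeta5 (weilEntry 0 (-1) 1 0 i j) := by
    simp [weilMatrix, ModularGroup.S]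
  simp only [e, e1, e2, e3, e4]
  simp only [eval, List.map_cons, List.map_nil, List.sum_cons, List.sum_nil, h1, h2, h3, h4]
  refine ⟨?_, ?_, ?_, ?_⟩ <;> push_cast <;> ring

lemma comb_slash (k : ℤ) (γ : SL(2, ℤ)) (f g : ℍ → ℂ) (x y : ℂ) :
    (fun τ => x * f τ + y * g τ) ∣[k] γ = fun τ => x * (f ∣[k] γ) τ + y * (g ∣[k] γ) τ := by
  rw [add_slash_fun, smul_slash_fun, smul_slash_fun]

/-- The exponents of the second order equation. -/
def kzExponent (i : Fin 2) : ℚ := if i = 0 then 2 / 5 else 3 / 5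

/-- A basis of solutions transforming under `S` by the standard matrix. -/
lemma exists_basis_slash_S : ∃ (a : Fin 2 → ℕ → ℂ) (u w : Fin 2 → ℍ → ℂ),
    (∀ i, a i 0 ≠ 0 ∧ HasQSeries (kzExponent i) (a i) (u i) ∧ IsSerrePair (u i) (w i)) ∧
    ∀ i, u i ∣[(5 : ℤ)] ModularGroup.S = fun τ => weilMatrix ModularGroup.S i 0 * u 0 τ +
      weilMatrix ModularGroup.S i 1 * u 1 τ := by
  obtain ⟨a₀, u₀, w₀, ha₀, hu₀, h₀⟩ := exists_isSerrePair (β := 2 / 5) (Or.inl rfl)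
  obtain ⟨a₁, u₁, w₁, ha₁, hu₁, h₁⟩ := exists_isSerrePair (β := 3 / 5) (Or.inr rfl)
  obtain ⟨c, hW⟩ := h₀.exists_wronskian h₁
  have hw : ∀ {β : ℚ} {a : ℕ → ℂ} {u w : ℍ → ℂ}, HasQSeries β a u → IsSerrePair u w → a 0 = 1 →
      ∃ b, b 0 = (β : ℂ) - 5 / 12 ∧ HasQSeries β b w := by
    intro β a u w hu h ha
    refine ⟨_, ?_, (hu.deriv.sub (((hasQSeries_eis2.mul hu).of_eq (zero_add β) (fun _ => rfl)
      (fun _ => rfl)).const_mul (5 / 12))).of_eq rfl (fun _ => rfl) fun τ => ?_⟩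
    · simp [ha, eisCoeff_zero]
    · rw [h.left.deriv]
      ring
  obtain ⟨b₀, hb₀, hw₀⟩ := hw hu₀ h₀ ha₀
  obtain ⟨b₁, hb₁, hw₁⟩ := hw hu₁ h₁ ha₁
  -- The leading coefficient of the Wronskian is the difference of the exponents, 1/5.
  have hc : c ≠ 0 := by
    rintro rfl
    have := ((hu₀.mul hw₁).sub ((hu₁.mul hw₀).of_eq (add_comm _ _) (fun _ => rfl)
      fun _ => rfl)).of_eq (g := 0) rfl (fun _ => rfl) (fun τ => by rw [hW τ, zero_mul]; rfl)
    have := this.eq_zero 0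
    simp [ha₀, ha₁, hb₀, hb₁] at this
    norm_num at this
  have hspan := fun {v z} (h : IsSerrePair v z) =>
    IsSerrePair.exists_linear_combination hc h₀ h₁ hW h
  have hind := fun {x y} => IsSerrePair.coeff_eq_zero hc h₀ h₁ hW (x := x) (y := y)
  obtain ⟨A, B, hS₀⟩ := hspan (h₀.slash ModularGroup.S)
  obtain ⟨C, E, hS₁⟩ := hspan (h₁.slash ModularGroup.S)
  set t := zeta5 with ht
  have hT₀ : u₀ ∣[(5 : ℤ)] ModularGroup.T = fun τ => t * u₀ τ + 0 * u₁ τ := funext fun τ => by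
    rw [hu₀.slash_T, ht, zeta5]; ring
  have hT₁ : u₁ ∣[(5 : ℤ)] ModularGroup.T = fun τ => 0 * u₀ τ + t ^ 4 * u₁ τ := funext fun τ => by
    rw [hu₁.slash_T, exp_three_fifths]; ring
  have t5 : t ^ 5 = 1 := zeta5_pow
  have tsum := zeta5_sum
  rw [← ht] at tsum
  have t0 : t ≠ 0 := zeta5_ne_zero
  have hSS : (u₀ ∣[(5 : ℤ)] ModularGroup.S) ∣[(5 : ℤ)] ModularGroup.S = fun τ => -u₀ τ := by
    rw [← SlashAction.slash_mul, show ModularGroup.S * ModularGroup.S = -1 by decide,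
      slash_neg_one (by decide)]
  -- The relation `TSTST = S`. Since `T` is diagonal with eigenvalues `t` and `t⁴`, this and `S² =
  -- -1` determine the matrix of `S` up to rescaling of `u₁`.
  have hrel : ((((u₀ ∣[(5 : ℤ)] ModularGroup.T) ∣[(5 : ℤ)] ModularGroup.S) ∣[(5 : ℤ)]
      ModularGroup.T) ∣[(5 : ℤ)] ModularGroup.S) ∣[(5 : ℤ)] ModularGroup.T = u₀ ∣[(5 : ℤ)] ModularGroup.S := by
    simp only [← SlashAction.slash_mul]
    congr 1
    decide
  rw [hS₀, comb_slash, hS₀, hS₁] at hSS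
  simp only [hT₀, hT₁, hS₀, hS₁, comb_slash] at hrel
  obtain ⟨r1, r2⟩ := hind (x := A ^ 2 + B * C + 1) (y := (A + E) * B) fun τ => by
    linear_combination congrFun hSS τ
  obtain ⟨r3, r4⟩ := hind (x := t ^ 3 * A ^ 2 + t * t ^ 5 * B * C - A)
    (y := t ^ 4 * (t ^ 2 * A + t ^ 5 * E) * B - B) fun τ => by
      linear_combination congrFun hrel τ
  -- If `B = 0` then `A² = -1` and `A = -t³`, so `t⁶ = -1`. With `t⁵ = 1` this gives `t = -1`, a
  -- contradiction.
  have hB : B ≠ 0 := by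
    rintro rfl
    have e1 : A ^ 2 = -1 := by linear_combination r1
    have e2 : A = -t ^ 3 := by linear_combination -r3 + t ^ 3 * e1
    rw [e2] at e1
    have e3 : t = -1 := by linear_combination e1 - t * t5
    rw [e3] at t5
    norm_num at t5
  have hE : E = -A := by
    have := (mul_eq_zero.mp r2).resolve_right hB
    linear_combination this
  have hA : A * (t ^ 2 - 1) = t := by
    have : t ^ 4 * (t ^ 2 * A + t ^ 5 * E) - 1 = 0 := (mul_eq_zero.mp
      (show B * _ = 0 by linear_combination r4)).resolve_left hB
    rw [hE, t5] at this
    linear_combination t * this - A * (t ^ 2 - 1) * t5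
  have ht2 : t ^ 2 - 1 ≠ 0 := by
    intro h
    rw [h, mul_zero] at hA
    exact t0 hA.symm
  obtain ⟨s1, s2, s3, s4⟩ := weilMatrix_S_values
  rw [← ht] at s1 s2 s3 s4
  have hg := eval_gaussSum5_ne_zero
  rw [← ht] at hg
  have hgv := eval_gaussSum5 t
  set g := eval t gaussSum5
  have hgA : A = g⁻¹ * (t ^ 3 - t ^ 2) := by
    rw [eq_inv_mul_iff_mul_eq₀ hg, hgv]
    refine mul_right_cancel₀ ht2 ?_
    linear_combination (t + t ^ 4 - t ^ 2 - t ^ 3) * hA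
  have hg2 : g ^ 2 = 5 := by rw [hgv]; exact gaussSum5_sq tsum
  have hb : B * C = (g⁻¹ * (t - t ^ 4)) ^ 2 := by
    have e1 : B * C = -1 - A ^ 2 := by linear_combination r1
    rw [e1, hgA]
    field_simp
    rw [hg2]
    linear_combination (-t + 4 - t ^ 3) * t5 - tsum
  have hb0 : g⁻¹ * (t - t ^ 4) ≠ 0 := by
    refine mul_ne_zero (inv_ne_zero hg) fun h => ht2 ?_
    linear_combination -(t ^ 4 + t ^ 7 + t ^ 10 + t ^ 13) * h -
      (t ^ 2 * (t ^ 10 + t ^ 5 + 1) - 1) * t5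
  set b := g⁻¹ * (t - t ^ 4) with hbdef
  -- Only the product `B C = b²` is intrinsic. Rescaling `u₁` makes both off-diagonal entries equal
  -- to `b`, as in the Weil representation.
  have hu₁' := hu₁.const_mul (B / b)
  have h₁' := h₁.const_mul (B / b)
  refine ⟨fun i => if i = 0 then a₀ else fun n => B / b * a₁ n,
    fun i => if i = 0 then u₀ else fun τ => B / b * u₁ τ,
    fun i => if i = 0 then w₀ else fun τ => B / b * w₁ τ, ?_, ?_⟩
  · intro i
    fin_cases i
    · exact ⟨by simp [ha₀], hu₀, h₀⟩
    · exact ⟨by simpa [ha₁] using ⟨hB, hb0⟩, hu₁', h₁'⟩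
  · intro i
    fin_cases i
    · simp only [Fin.zero_eta, Fin.isValue, if_true, one_ne_zero, if_false]
      rw [hS₀, s1, s2, ← hgA]
      funext τ
      field_simp
    · simp only [Fin.mk_one, Fin.isValue, if_true, one_ne_zero, if_false]
      rw [smul_slash_fun, hS₁, s3, s4, ← hgA, hE]
      funext τ
      field_simp
      linear_combination u₀ τ * hb

/-! ### The action of the full modular group -/

open RootSum

lemma det_cast (R : Type*) [CommRing R] (γ : SL(2, ℤ)) :
    ((γ 0 0 : ℤ) : R) * ((γ 1 1 : ℤ) : R) - ((γ 0 1 : ℤ) : R) * ((γ 1 0 : ℤ) : R) = 1 := by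
  have := γ.det_coe
  rw [Matrix.det_fin_two] at this
  exact_mod_cast congrArg (Int.cast : ℤ → R) this

lemma mul_S_apply (γ : SL(2, ℤ)) : (γ * ModularGroup.S) 0 0 = γ 0 1 ∧
    (γ * ModularGroup.S) 0 1 = -γ 0 0 ∧ (γ * ModularGroup.S) 1 0 = γ 1 1 ∧
    (γ * ModularGroup.S) 1 1 = -γ 1 0 := by
  simp [ModularGroup.coe_S, Matrix.mul_apply, Fin.sum_univ_two]

lemma mul_T_apply (γ : SL(2, ℤ)) : (γ * ModularGroup.T) 0 0 = γ 0 0 ∧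
    (γ * ModularGroup.T) 0 1 = γ 0 0 + γ 0 1 ∧ (γ * ModularGroup.T) 1 0 = γ 1 0 ∧
    (γ * ModularGroup.T) 1 1 = γ 1 0 + γ 1 1 := by
  simp [ModularGroup.coe_T, Matrix.mul_apply, Fin.sum_univ_two]

lemma weilMatrix_mul_S (γ : SL(2, ℤ)) (i j : Fin 2) : weilMatrix (γ * ModularGroup.S) i j =
    weilMatrix γ i 0 * weilMatrix ModularGroup.S 0 j +
      weilMatrix γ i 1 * weilMatrix ModularGroup.S 1 j := by
  have h := eval_eq_of_coeff zeta5_sum (weilEntry_S _ _ _ _ (det_cast (ZMod 5) γ) i j)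
  rw [eval_append, eval_mul zeta5_pow, eval_mul zeta5_pow, eval_mul zeta5_pow] at h
  have e (i j) : weilMatrix ModularGroup.S i j =
      (eval zeta5 gaussSum5)⁻¹ * eval zeta5 (weilEntry 0 (-1) 1 0 i j) := by
    simp [weilMatrix, ModularGroup.S]
  obtain ⟨h1, h2, h3, h4⟩ := mul_S_apply γ
  rw [e, e, weilMatrix, h1, h2, h3, h4, weilMatrix, weilMatrix]
  push_cast
  have hg := eval_gaussSum5_ne_zero
  field_simp
  linear_combination h

lemma weilMatrix_mul_T (γ : SL(2, ℤ)) (i j : Fin 2) : weilMatrix (γ * ModularGroup.T) i j =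
    weilMatrix γ i j * zeta5 ^ (weilIndex j ^ 2).val := by
  have h := eval_eq_of_coeff zeta5_sum (weilEntry_T _ _ _ _ (det_cast (ZMod 5) γ) i j)
  rw [eval_mul zeta5_pow] at h
  obtain ⟨h1, h2, h3, h4⟩ := mul_T_apply γ
  rw [weilMatrix, h1, h2, h3, h4, weilMatrix]
  push_cast
  rw [h]
  simp [eval]
  ring

lemma weilMatrix_eq_one {γ : SL(2, ℤ)} (hγ : γ ∈ CongruenceSubgroup.Gamma 5) (i j : Fin 2) :
    weilMatrix γ i j = if i = j then 1 else 0 := by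
  rw [CongruenceSubgroup.Gamma_mem] at hγ
  obtain ⟨h1, h2, h3, h4⟩ := hγ
  have e : weilEntry 1 0 0 1 i j = mul gaussSum5 [(if i = j then 1 else 0, 0)] := by
    revert i j
    decide
  rw [weilMatrix, h1, h2, h3, h4, e, eval_mul zeta5_pow, inv_mul_cancel_left₀ eval_gaussSum5_ne_zero]
  simp only [eval]
  split_ifs <;> simp

lemma slash_injective (k : ℤ) (γ : SL(2, ℤ)) {f g : ℍ → ℂ} (h : f ∣[k] γ = g ∣[k] γ) : f = g := by
  have := congrArg (fun F => F ∣[k] γ⁻¹) h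
  simpa [← SlashAction.slash_mul] using this

lemma kzExponent_exp (i : Fin 2) : Complex.exp (2 * Real.pi * Complex.I * (kzExponent i : ℂ)) =
    zeta5 ^ (weilIndex i ^ 2).val := by
  fin_cases i
  · change Complex.exp (2 * Real.pi * Complex.I * ((2 / 5 : ℚ) : ℂ)) = zeta5 ^ 1
    rw [zeta5, pow_one]
  · exact exp_three_fifths

/-- A property of `SL₂(ℤ)` stable under right multiplication by the generators and their
inverses. -/
lemma SL2Z_induction {P : SL(2, ℤ) → Prop} (one : P 1)
    (S : ∀ γ, P γ ↔ P (γ * ModularGroup.S)) (T : ∀ γ, P γ ↔ P (γ * ModularGroup.T))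
    (γ : SL(2, ℤ)) : P γ := by
  have hγ : γ ∈ Subgroup.closure {ModularGroup.S, ModularGroup.T} := by
    simp [SpecialLinearGroup.SL2Z_generators]
  induction hγ using Subgroup.closure_induction_right with
  | one => exact one
  | mul_right x _ y hy h =>
    rcases hy with rfl | rfl
    · exact (S x).mp h
    · exact (T x).mp h
  | mul_inv_cancel x _ y hy h =>
    rcases hy with rfl | rfl
    · rw [S, inv_mul_cancel_right]
      exact h
    · rw [T, inv_mul_cancel_right]
      exact h

/-- A basis of solutions on which `SL₂(ℤ)` acts through the odd part of the Weil representation of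
`SL₂(𝔽₅)`. -/
lemma exists_basis_slash : ∃ (a : Fin 2 → ℕ → ℂ) (u w : Fin 2 → ℍ → ℂ),
    (∀ i, a i 0 ≠ 0 ∧ HasQSeries (kzExponent i) (a i) (u i) ∧ IsSerrePair (u i) (w i)) ∧
    ∀ γ i, u i ∣[(5 : ℤ)] γ = (fun τ => weilMatrix γ i 0 * u 0 τ + weilMatrix γ i 1 * u 1 τ) ∧
      w i ∣[(7 : ℤ)] γ = fun τ => weilMatrix γ i 0 * w 0 τ + weilMatrix γ i 1 * w 1 τ := by
  obtain ⟨a, u, w, h, hS⟩ := exists_basis_slash_S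
  have hu : ∀ γ : SL(2, ℤ), ∀ i, u i ∣[(5 : ℤ)] γ =
      fun τ => weilMatrix γ i 0 * u 0 τ + weilMatrix γ i 1 * u 1 τ := by
    refine SL2Z_induction (fun i => ?_) (fun γ => forall_congr' fun i => ?_)
      (fun γ => forall_congr' fun i => ?_)
    · simp only [SlashAction.slash_one, weilMatrix_eq_one (one_mem _)]
      fin_cases i <;> simp
    · have e : (fun τ => weilMatrix (γ * ModularGroup.S) i 0 * u 0 τ +
          weilMatrix (γ * ModularGroup.S) i 1 * u 1 τ) =
          (fun τ => weilMatrix γ i 0 * u 0 τ + weilMatrix γ i 1 * u 1 τ) ∣[(5 : ℤ)]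
            ModularGroup.S := by
        rw [comb_slash, hS, hS]
        funext τ
        simp only [weilMatrix_mul_S]
        ring
      rw [e, SlashAction.slash_mul]
      exact ⟨fun h => by rw [h], slash_injective 5 _⟩
    · have e : (fun τ => weilMatrix (γ * ModularGroup.T) i 0 * u 0 τ +
          weilMatrix (γ * ModularGroup.T) i 1 * u 1 τ) =
          (fun τ => weilMatrix γ i 0 * u 0 τ + weilMatrix γ i 1 * u 1 τ) ∣[(5 : ℤ)]
            ModularGroup.T := by
        rw [comb_slash]
        funext τ
        simp only [weilMatrix_mul_T, (h 0).2.1.slash_T, (h 1).2.1.slash_T, kzExponent_exp]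
        ring
      rw [e, SlashAction.slash_mul]
      exact ⟨fun h => by rw [h], slash_injective 5 _⟩
  refine ⟨a, u, w, h, fun γ i => ⟨hu γ i, ?_⟩⟩
  -- The law for `w` comes for free, since `w` is determined by `u` through the first order system.
  have h1 := (h i).2.2.slash γ
  rw [hu] at h1
  exact h1.right_unique (((h 0).2.2.const_mul _).add ((h 1).2.2.const_mul _))

/-! ### The sign character of `η¹²` -/

/-- The character of `η¹²`, on matrix entries modulo `2`. -/
def etaSign (a b c d : ZMod 2) : ℤ := if a + d = 1 ∨ (b = 0 ∧ c = 0) then 1 else -1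

/-- Both generators act by `-1`, so the character is the sign character of `SL₂(𝔽₂) ≅ S₃`: trace 1
singles out the elements of order three, and in trace 0 only the identity is even. -/
lemma slash_eta12 (γ : SL(2, ℤ)) : eta12 ∣[(6 : ℤ)] γ =
    fun τ => (etaSign (γ 0 0) (γ 0 1) (γ 1 0) (γ 1 1) : ℂ) * eta12 τ := by
  have key : ∀ a b c d : ZMod 2, a * d - b * c = 1 → etaSign b (-a) d (-c) = -etaSign a b c d ∧
      etaSign a (a + b) c (c + d) = -etaSign a b c d := by decide
  revert γ
  refine SL2Z_induction ?_ (fun γ => ?_) (fun γ => ?_)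
  · simp [etaSign]
  · obtain ⟨h1, h2, h3, h4⟩ := mul_S_apply γ
    have e : (fun τ => (etaSign ((γ * ModularGroup.S) 0 0) ((γ * ModularGroup.S) 0 1)
        ((γ * ModularGroup.S) 1 0) ((γ * ModularGroup.S) 1 1) : ℂ) * eta12 τ) =
        (fun τ => (etaSign (γ 0 0) (γ 0 1) (γ 1 0) (γ 1 1) : ℂ) * eta12 τ) ∣[(6 : ℤ)]
          ModularGroup.S := by
      rw [smul_slash_fun, slash_S_eta12, h1, h2, h3, h4]
      push_cast
      rw [(key _ _ _ _ (det_cast (ZMod 2) γ)).1]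
      funext τ
      push_cast
      ring
    rw [e, SlashAction.slash_mul]
    exact ⟨fun h => by rw [h], slash_injective 6 _⟩
  · obtain ⟨h1, h2, h3, h4⟩ := mul_T_apply γ
    have e : (fun τ => (etaSign ((γ * ModularGroup.T) 0 0) ((γ * ModularGroup.T) 0 1)
        ((γ * ModularGroup.T) 1 0) ((γ * ModularGroup.T) 1 1) : ℂ) * eta12 τ) =
        (fun τ => (etaSign (γ 0 0) (γ 0 1) (γ 1 0) (γ 1 1) : ℂ) * eta12 τ) ∣[(6 : ℤ)]
          ModularGroup.T := by
      rw [smul_slash_fun, slash_T_eta12, h1, h2, h3, h4]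
      push_cast
      rw [(key _ _ _ _ (det_cast (ZMod 2) γ)).2]
      funext τ
      push_cast
      ring
    rw [e, SlashAction.slash_mul]
    exact ⟨fun h => by rw [h], slash_injective 6 _⟩

/-- Negative powers of `η¹²` have a character of level `2`. -/
lemma exists_slash_eta12_inv (m : ℕ) (γ : SL(2, ℤ)) : ∃ ε : ℂ, ε ≠ 0 ∧
    (γ ∈ CongruenceSubgroup.Gamma 2 → ε = 1) ∧
    (fun τ => (eta12 τ ^ m)⁻¹) ∣[(-6 * m : ℤ)] γ = fun τ => ε * (eta12 τ ^ m)⁻¹ := by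
  refine ⟨((etaSign (γ 0 0) (γ 0 1) (γ 1 0) (γ 1 1) : ℂ) ^ m)⁻¹, ?_, fun hγ => ?_, ?_⟩
  · rw [etaSign]
    split_ifs <;> simp
  · rw [CongruenceSubgroup.Gamma_mem] at hγ
    obtain ⟨h1, h2, h3, h4⟩ := hγ
    simp [etaSign, h2, h3]
  · funext τ
    have h := congrFun (slash_eta12 γ) τ
    rw [ModularForm.SL_slash_apply] at h ⊢
    have hd := denom_ne_zero γ τ
    rw [← mul_inv, ← mul_pow, ← h, mul_pow, mul_inv, ← zpow_natCast (denom γ τ ^ (-6 : ℤ)),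
      ← zpow_mul, ← zpow_neg]

/-! ### Solutions of the form `E₂ A + B` -/

/-- A criterion for `E₂ A + B` to be a solution, in terms of iterated Serre derivatives. -/
lemma isSolution_of_serre_chain {s : ℂ} {A B : ℕ → ℍ → ℂ}
    (hA : ∀ i < 4, HasD (A i) fun τ => A (i + 1) τ + (2 * i - 1) / 12 * eis2 τ * A i τ)
    (hB : ∀ i < 4, HasD (B i) fun τ => B (i + 1) τ + (2 * i + 1) / 12 * eis2 τ * B i τ)
    (h₁ : ∀ τ, A 4 τ + (coeff1 s - 25 / 72) * eis4 τ * A 2 τ +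
      (coeff2 s + coeff1 s / 6 - 1 / 216) * eis6 τ * A 1 τ +
      (coeff3 s - coeff1 s / 144 - 1 / 768) * eis4 τ ^ 2 * A 0 τ + B 3 τ / 3 +
      (coeff1 s / 6 - 23 / 432) * eis4 τ * B 1 τ +
      (coeff2 s / 12 + coeff1 s / 72 - 1 / 648) * eis6 τ * B 0 τ = 0)
    (h₂ : ∀ τ, B 4 τ + (coeff1 s - 25 / 72) * eis4 τ * B 2 τ +
      (coeff2 s + coeff1 s / 6 - 1 / 72) * eis6 τ * B 1 τ +
      (coeff3 s - coeff1 s / 144 + 7 / 6912) * eis4 τ ^ 2 * B 0 τ - eis4 τ * A 3 τ / 3 +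
      eis6 τ * A 2 τ / 6 + (-coeff1 s / 6 - 1 / 432) * eis4 τ ^ 2 * A 1 τ +
      (5 / 2592 + coeff1 s / 72 - coeff2 s / 12) * eis4 τ * eis6 τ * A 0 τ = 0) :
    IsSolution s fun τ => eis2 τ * A 0 τ + B 0 τ := by
  have h0 : HasD (fun τ => 
      eis2 τ * A 0 τ + B 0 τ)
      (fun τ => (-1/12) * eis4 τ * A 0 τ + eis2 τ * A 1 τ + 1/12 * eis2 τ * B 0 τ + B 1 τ) := by
    refine HasD.congr
      ((hasD_eis2.mul (hA 0 (by norm_num))).add (hB 0 (by norm_num)))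
      (fun τ => ?_) (fun τ => ?_)
    · ring
    · push_cast
      ring
  have h1 : HasD (fun τ => 
      (-1/12) * eis4 τ * A 0 τ + eis2 τ * A 1 τ + 1/12 * eis2 τ * B 0 τ + B 1 τ)
      (fun τ => 1/36 * eis6 τ * A 0 τ - 1/48 * eis2 τ * eis4 τ * A 0 τ - 1/6 * eis4 τ * A 1
      τ + 1/6 * eis2 τ ^ 2 * A 1 τ + eis2 τ * A 2 τ - 1/144 * eis4 τ * B 0 τ + 1/72 * eis2 τ
      ^ 2 * B 0 τ + 1/3 * eis2 τ * B 1 τ + B 2 τ) := by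
    refine HasD.congr
      (((((hasD_eis4.mul (hA 0 (by norm_num))).const_mul (-1/12)).add (hasD_eis2.mul (hA 1
      (by norm_num)))).add ((hasD_eis2.mul (hB 0 (by norm_num))).const_mul (1/12))).add (hB
      1 (by norm_num)))
      (fun τ => ?_) (fun τ => ?_)
    · ring
    · push_cast
      ring
  have h2 : HasD (fun τ => 
      1/36 * eis6 τ * A 0 τ - 1/48 * eis2 τ * eis4 τ * A 0 τ - 1/6 * eis4 τ * A 1 τ + 1/6 *
      eis2 τ ^ 2 * A 1 τ + eis2 τ * A 2 τ - 1/144 * eis4 τ * B 0 τ + 1/72 * eis2 τ ^ 2 * B 0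
      τ + 1/3 * eis2 τ * B 1 τ + B 2 τ)
      (fun τ => (-7/576) * eis4 τ ^ 2 * A 0 τ + 1/54 * eis2 τ * eis6 τ * A 0 τ - 1/144 *
      eis2 τ ^ 2 * eis4 τ * A 0 τ + 1/12 * eis6 τ * A 1 τ - 17/144 * eis2 τ * eis4 τ * A 1 τ
      + 1/24 * eis2 τ ^ 3 * A 1 τ - 1/4 * eis4 τ * A 2 τ + 1/2 * eis2 τ ^ 2 * A 2 τ + eis2 τ
      * A 3 τ + 1/432 * eis6 τ * B 0 τ - 1/192 * eis2 τ * eis4 τ * B 0 τ + 1/288 * eis2 τ ^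
      3 * B 0 τ - 5/144 * eis4 τ * B 1 τ + 1/8 * eis2 τ ^ 2 * B 1 τ + 3/4 * eis2 τ * B 2 τ +
      B 3 τ) := by
    refine HasD.congr
      ((((((((((hasD_eis6.mul (hA 0 (by norm_num))).const_mul (1/36)).add (((hasD_eis2.mul
      hasD_eis4).mul (hA 0 (by norm_num))).const_mul (-1/48))).add ((hasD_eis4.mul (hA 1 (by
      norm_num))).const_mul (-1/6))).add (((hasD_eis2.pow 2).mul (hA 1 (by
      norm_num))).const_mul (1/6))).add (hasD_eis2.mul (hA 2 (by norm_num)))).add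
      ((hasD_eis4.mul (hB 0 (by norm_num))).const_mul (-1/144))).add (((hasD_eis2.pow 2).mul
      (hB 0 (by norm_num))).const_mul (1/72))).add ((hasD_eis2.mul (hB 1 (by
      norm_num))).const_mul (1/3))).add (hB 2 (by norm_num)))
      (fun τ => ?_) (fun τ => ?_)
    · ring
    · push_cast
      ring
  have h3 : HasD (fun τ => 
      (-7/576) * eis4 τ ^ 2 * A 0 τ + 1/54 * eis2 τ * eis6 τ * A 0 τ - 1/144 * eis2 τ ^ 2 *
      eis4 τ * A 0 τ + 1/12 * eis6 τ * A 1 τ - 17/144 * eis2 τ * eis4 τ * A 1 τ + 1/24 *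
      eis2 τ ^ 3 * A 1 τ - 1/4 * eis4 τ * A 2 τ + 1/2 * eis2 τ ^ 2 * A 2 τ + eis2 τ * A 3 τ
      + 1/432 * eis6 τ * B 0 τ - 1/192 * eis2 τ * eis4 τ * B 0 τ + 1/288 * eis2 τ ^ 3 * B 0
      τ - 5/144 * eis4 τ * B 1 τ + 1/8 * eis2 τ ^ 2 * B 1 τ + 3/4 * eis2 τ * B 2 τ + B 3 τ)
      (fun τ => 17/2592 * eis4 τ * eis6 τ * A 0 τ - 35/2304 * eis2 τ * eis4 τ ^ 2 * A 0 τ +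
      5/432 * eis2 τ ^ 2 * eis6 τ * A 0 τ - 5/1728 * eis2 τ ^ 3 * eis4 τ * A 0 τ - 19/432 *
      eis4 τ ^ 2 * A 1 τ + 23/216 * eis2 τ * eis6 τ * A 1 τ - 11/144 * eis2 τ ^ 2 * eis4 τ *
      A 1 τ + 1/72 * eis2 τ ^ 4 * A 1 τ + 1/6 * eis6 τ * A 2 τ - 25/72 * eis2 τ * eis4 τ * A
      2 τ + 1/4 * eis2 τ ^ 3 * A 2 τ - 1/3 * eis4 τ * A 3 τ + eis2 τ ^ 2 * A 3 τ + eis2 τ *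
      A 4 τ - 5/6912 * eis4 τ ^ 2 * B 0 τ + 1/324 * eis2 τ * eis6 τ * B 0 τ - 1/288 * eis2 τ
      ^ 2 * eis4 τ * B 0 τ + 1/864 * eis2 τ ^ 4 * B 0 τ + 1/72 * eis6 τ * B 1 τ - 5/108 *
      eis2 τ * eis4 τ * B 1 τ + 1/18 * eis2 τ ^ 3 * B 1 τ - 7/72 * eis4 τ * B 2 τ + 1/2 *
      eis2 τ ^ 2 * B 2 τ + 4/3 * eis2 τ * B 3 τ + B 4 τ) := by
    refine HasD.congr
      ((((((((((((((((((hasD_eis4.pow 2).mul (hA 0 (by norm_num))).const_mul (-7/576)).add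
      (((hasD_eis2.mul hasD_eis6).mul (hA 0 (by norm_num))).const_mul (1/54))).add
      ((((hasD_eis2.pow 2).mul hasD_eis4).mul (hA 0 (by norm_num))).const_mul (-1/144))).add
      ((hasD_eis6.mul (hA 1 (by norm_num))).const_mul (1/12))).add (((hasD_eis2.mul
      hasD_eis4).mul (hA 1 (by norm_num))).const_mul (-17/144))).add (((hasD_eis2.pow 3).mul
      (hA 1 (by norm_num))).const_mul (1/24))).add ((hasD_eis4.mul (hA 2 (by
      norm_num))).const_mul (-1/4))).add (((hasD_eis2.pow 2).mul (hA 2 (by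
      norm_num))).const_mul (1/2))).add (hasD_eis2.mul (hA 3 (by norm_num)))).add
      ((hasD_eis6.mul (hB 0 (by norm_num))).const_mul (1/432))).add (((hasD_eis2.mul
      hasD_eis4).mul (hB 0 (by norm_num))).const_mul (-1/192))).add (((hasD_eis2.pow 3).mul
      (hB 0 (by norm_num))).const_mul (1/288))).add ((hasD_eis4.mul (hB 1 (by
      norm_num))).const_mul (-5/144))).add (((hasD_eis2.pow 2).mul (hB 1 (by
      norm_num))).const_mul (1/8))).add ((hasD_eis2.mul (hB 2 (by norm_num))).const_mul
      (3/4))).add (hB 3 (by norm_num)))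
      (fun τ => ?_) (fun τ => ?_)
    · ring
    · push_cast
      ring
  refine ⟨h0.mdiff, fun τ => ?_⟩
  have e2 := ((hasD_eis2.pow 2).sub hasD_eis4).const_mul (1 / 12)
  have e2' : qD eis2 = fun τ => 1 / 12 * (eis2 τ ^ 2 - eis4 τ) := by
    rw [hasD_eis2.qD_eq]
    funext τ
    ring
  simp only [Function.iterate_succ, Function.iterate_zero, Function.comp_apply, id_eq, h0.qD_eq,
    h1.qD_eq, h2.qD_eq, h3.qD_eq, e2', e2.qD_eq, hasD_eis4.qD_eq, eis8_eq]
  push_cast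
  -- After Ramanujan's identities all powers of `E₂` above the first cancel. The coefficient of `E₂`
  -- is `h₁`, and the remainder is `h₂`.
  linear_combination eis2 τ * h₁ τ + h₂ τ

/-! ### Formal Serre derivatives and verification of the explicit solutions -/

/-- Integral combinations of `E₄^a E₆^b u` and `60 E₄^a E₆^b w`, for a Serre pair `(u, w)`; the
boolean selects `w`. -/
abbrev SerrePoly := List (ℤ × ℕ × ℕ × Bool)

namespace SerrePoly

def weight (p : ℤ × ℕ × ℕ × Bool) : ℕ := 4 * p.2.1 + 6 * p.2.2.1 + if p.2.2.2 then 7 else 5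

def evalMono (u w : ℍ → ℂ) (p : ℤ × ℕ × ℕ × Bool) (τ : ℍ) : ℂ :=
  p.1 * (eis4 τ ^ p.2.1 * eis6 τ ^ p.2.2.1 * if p.2.2.2 then 60 * w τ else u τ)

/-- The value of a formal combination, multiplied by a function `x`. -/
def eval (x u w : ℍ → ℂ) (l : SerrePoly) (τ : ℍ) : ℂ :=
  x τ * (l.map fun p => evalMono u w p τ).sum

def insertMono (p : ℤ × ℕ × ℕ × Bool) : SerrePoly → SerrePoly
  | [] => [p]
  | q :: l => if p.2 = q.2 then (p.1 + q.1, q.2) :: l else q :: insertMono p l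

/-- Collects equal monomials and drops vanishing ones. -/
def normalize (l : SerrePoly) : SerrePoly :=
  (l.foldr insertMono []).filter fun p => p.1 ≠ 0

/-- With `ϑ` the Serre derivative, `60 ϑ` sends `u` to `60 w`, `60 w` to `11 E₄ u`, `E₄` to `-20 E₆`
and `E₆` to `-30 E₄²`, so all coefficients stay integral. Truncated subtraction at exponent 0 is
harmless because the coefficient is then 0. `theta` removes such terms by normalising; their weight
would be wrong. -/
def thetaMono (p : ℤ × ℕ × ℕ × Bool) : SerrePoly :=
  [(if p.2.2.2 then 11 * p.1 else p.1, if p.2.2.2 then p.2.1 + 1 else p.2.1, p.2.2.1, !p.2.2.2),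
    (-20 * p.2.1 * p.1, p.2.1 - 1, p.2.2.1 + 1, p.2.2.2),
    (-30 * p.2.2.1 * p.1, p.2.1 + 2, p.2.2.1 - 1, p.2.2.2)]

/-- Sixty times the Serre derivative. -/
def theta (l : SerrePoly) : SerrePoly := normalize (l.flatMap thetaMono)

def shift (c : ℤ) (a b : ℕ) (l : SerrePoly) : SerrePoly :=
  l.map fun p => (c * p.1, p.2.1 + a, p.2.2.1 + b, p.2.2.2)

variable {x u w : ℍ → ℂ}

lemma eval_nil (τ : ℍ) : eval x u w [] τ = 0 := by simp [eval]

lemma eval_cons (p : ℤ × ℕ × ℕ × Bool) (l : SerrePoly) (τ : ℍ) :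
    eval x u w (p :: l) τ = x τ * evalMono u w p τ + eval x u w l τ := by
  simp [eval, mul_add]

lemma eval_append (l l' : SerrePoly) (τ : ℍ) :
    eval x u w (l ++ l') τ = eval x u w l τ + eval x u w l' τ := by
  simp [eval, mul_add]

lemma eval_insertMono (p : ℤ × ℕ × ℕ × Bool) (l : SerrePoly) (τ : ℍ) :
    eval x u w (insertMono p l) τ = eval x u w (p :: l) τ := by
  induction l with
  | nil => rfl
  | cons q l ih =>
    rw [insertMono]
    split_ifs with h
    · simp only [eval_cons, evalMono, h]
      push_cast
      ring
    · rw [eval_cons, ih]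
      simp only [eval_cons]
      ring

lemma eval_normalize (l : SerrePoly) (τ : ℍ) : eval x u w (normalize l) τ = eval x u w l τ := by
  have h1 : ∀ l : SerrePoly, eval x u w (l.filter fun p => p.1 ≠ 0) τ = eval x u w l τ := by
    intro l
    induction l with
    | nil => rfl
    | cons p l ih =>
      by_cases h : p.1 = 0
      · rw [List.filter_cons_of_neg (by simp [h]), ih, eval_cons, evalMono, h]
        simp
      · rw [List.filter_cons_of_pos (by simpa using h), eval_cons, ih, eval_cons]
  rw [normalize, h1]
  induction l with
  | nil => rfl
  | cons p l ih => rw [List.foldr_cons, eval_insertMono, eval_cons, ih, eval_cons]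

lemma eval_shift (c : ℤ) (a b : ℕ) (l : SerrePoly) (τ : ℍ) :
    eval x u w (shift c a b l) τ = c * eis4 τ ^ a * eis6 τ ^ b * eval x u w l τ := by
  induction l with
  | nil => simp [shift, eval_nil]
  | cons p l ih =>
    have : shift c a b (p :: l) = (c * p.1, p.2.1 + a, p.2.2.1 + b, p.2.2.2) :: shift c a b l := rfl
    rw [this, eval_cons, ih, eval_cons, evalMono, evalMono]
    push_cast
    ring

lemma hasD_evalMono (h : IsSerrePair u w) (p : ℤ × ℕ × ℕ × Bool) : HasD (evalMono u w p)
    fun τ => ((thetaMono p).map fun q => evalMono u w q τ).sum / 60 +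
      weight p / 12 * eis2 τ * evalMono u w p τ := by
  obtain ⟨c, a, b, e⟩ := p
  have hv : HasD (fun τ => if e then 60 * w τ else u τ) fun τ =>
      (if e then 11 / 60 * eis4 τ * u τ else w τ) +
        (if e then 7 else 5 : ℕ) / 12 * eis2 τ * if e then 60 * w τ else u τ := by
    cases e
    · exact h.left.congr (fun τ => by simp) fun τ => by simp
    · exact (h.right.const_mul 60).congr (fun τ => by simp) fun τ => by simp; ring
  have h4 : HasD (fun τ => eis4 τ ^ a) fun τ => -(a : ℂ) / 3 * (eis4 τ ^ (a - 1) * eis6 τ) +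
      a / 3 * eis2 τ * eis4 τ ^ a := by
    refine (hasD_eis4.pow a).congr (fun _ => rfl) fun τ => ?_
    rcases a with _ | a
    · simp
    · rw [Nat.add_sub_cancel]; ring
  have h6 : HasD (fun τ => eis6 τ ^ b) fun τ => -(b : ℂ) / 2 * (eis4 τ ^ 2 * eis6 τ ^ (b - 1)) +
      b / 2 * eis2 τ * eis6 τ ^ b := by
    refine (hasD_eis6.pow b).congr (fun _ => rfl) fun τ => ?_
    rcases b with _ | b
    · simp
    · rw [Nat.add_sub_cancel]; ring
  refine (((h4.mul h6).mul hv).const_mul c).congr (fun _ => rfl) fun τ => ?_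
  simp only [thetaMono, evalMono, weight, List.map_cons, List.map_nil, List.sum_cons, List.sum_nil]
  cases e <;> simp <;> ring

/-- The hypothesis on `x` says that its Serre derivative in weight `-6 m` vanishes. Multiplication
by `x` therefore only shifts the weight. -/
lemma hasD_eval (h : IsSerrePair u w) {m : ℂ} (hx : HasD x fun τ => -m / 2 * eis2 τ * x τ)
    {l : SerrePoly} {k : ℂ} (hl : ∀ p ∈ l, (weight p : ℂ) = k + 6 * m) :
    HasD (eval x u w l) fun τ => eval x u w (theta l) τ / 60 + k / 12 * eis2 τ * eval x u w l τ := by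
  simp only [theta, eval_normalize]
  induction l with
  | nil => exact (HasD.const 0).congr (fun τ => (eval_nil τ).symm) fun τ => by simp [eval_nil]
  | cons p l ih =>
    refine ((hx.mul (hasD_evalMono h p)).add (ih fun q hq => hl q (List.mem_cons_of_mem _ hq))).congr
      (fun τ => (eval_cons p l τ).symm) fun τ => ?_
    rw [List.flatMap_cons, eval_append, eval_cons, hl p List.mem_cons_self]
    simp only [eval]
    ring

/-- The two conditions for `E₂ A + B` to solve the equation with parameter `2 r / 5`. -/
def conditions (r : ℤ) (A B : SerrePoly) : SerrePoly × SerrePoly :=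
  let A' := theta^[1] A
  let A'' := theta^[2] A
  let B' := theta^[1] B
  let B'' := theta^[2] B
  let b := -20 * r ^ 2 + 240 * r + 6660
  let c := (r + 3) ^ 2
  let d := (r - 45) * (r + 15) * (r + 3) ^ 2 - (-50 * r ^ 2 + 600 * r + 16650)
  (theta^[4] A ++ shift (-2 * r ^ 2 + 24 * r - 584) 1 0 A'' ++ shift (60 * c + b - 1000) 0 1 A' ++
      shift (d - 16875) 2 0 A ++ shift 20 0 0 (theta^[3] B) ++ shift (b - 11500) 1 0 B' ++
      shift (300 * c + 5 * b - 20000) 0 1 B,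
    theta^[4] B ++ shift (-2 * r ^ 2 + 24 * r - 584) 1 0 B'' ++ shift (60 * c + b - 3000) 0 1 B' ++
      shift (d + 13125) 2 0 B ++ shift (-20) 1 0 (theta^[3] A) ++ shift 600 0 1 A'' ++
      shift (-b - 500) 2 0 A' ++ shift (25000 + 5 * b - 300 * c) 1 1 A)

/-- The combinations `A`, `B` have weights `6 m - 1`, `6 m + 1` and satisfy the conditions. -/
def IsQuasiSolution (r : ℤ) (m : ℕ) (A B : SerrePoly) : Prop :=
  ((∀ i < 4, ∀ p ∈ theta^[i] A, weight p + 1 = 6 * m + 2 * i) ∧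
    ∀ i < 4, ∀ p ∈ theta^[i] B, weight p = 6 * m + 1 + 2 * i) ∧
  normalize (conditions r A B).1 = [] ∧ normalize (conditions r A B).2 = []

instance (r : ℤ) (m : ℕ) (A B : SerrePoly) : Decidable (IsQuasiSolution r m A B) :=
  inferInstanceAs (Decidable (_ ∧ _))

lemma IsQuasiSolution.isSolution {r : ℤ} {m : ℕ} {A B : SerrePoly} (h : IsQuasiSolution r m A B)
    (huw : IsSerrePair u w) (hx : HasD x fun τ => -(m : ℂ) / 2 * eis2 τ * x τ) :
    IsSolution (2 * r / 5) fun τ => eis2 τ * eval x u w A τ + eval x u w B τ := by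
  obtain ⟨⟨hA, hB⟩, h₁, h₂⟩ := h
  have key := isSolution_of_serre_chain (s := 2 * r / 5)
    (A := fun i τ => (1 / 60 ^ i) * eval x u w (theta^[i] A) τ)
    (B := fun i τ => (1 / 60 ^ i) * eval x u w (theta^[i] B) τ) ?_ ?_ ?_ ?_
  · simpa using key
  · intro i hi
    refine ((hasD_eval (k := 2 * i - 1) huw hx fun p hp => ?_).const_mul _).congr (fun _ => rfl)
      fun τ => ?_
    · have := hA i hi p hp
      have : (weight p : ℂ) + 1 = 6 * m + 2 * i := by exact_mod_cast this
      linear_combination this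
    · rw [Function.iterate_succ_apply', pow_succ]
      ring
  · intro i hi
    refine ((hasD_eval (k := 2 * i + 1) huw hx fun p hp => ?_).const_mul _).congr (fun _ => rfl)
      fun τ => ?_
    · have := hB i hi p hp
      have : (weight p : ℂ) = 6 * m + 1 + 2 * i := by exact_mod_cast this
      linear_combination this
    · rw [Function.iterate_succ_apply', pow_succ]
      ring
  · intro τ
    have := eval_normalize (x := x) (u := u) (w := w) (conditions r A B).1 τ
    rw [h₁, eval_nil] at this
    simp only [conditions, eval_append, eval_shift] at this
    simp only [coeff1, coeff2, coeff3, Function.iterate_zero, id_eq]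
    push_cast at this
    -- `conditions` is the criterion with `s = 2 r / 5`, multiplied by `60⁴`; each application of
    -- `theta` accounts for one factor 60.
    linear_combination -(1 / 60 ^ 4) * this
  · intro τ
    have := eval_normalize (x := x) (u := u) (w := w) (conditions r A B).2 τ
    rw [h₂, eval_nil] at this
    simp only [conditions, eval_append, eval_shift] at this
    simp only [coeff1, coeff2, coeff3, Function.iterate_zero, id_eq]
    push_cast at this
    linear_combination -(1 / 60 ^ 4) * this

end SerrePoly

/-! ### Modularity and leading terms of the explicit combinations -/

lemma pow_slash_of_slash {k : ℤ} {γ : SL(2, ℤ)} {f : ℍ → ℂ} (h : f ∣[k] γ = f) (n : ℕ) :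
    (fun τ => f τ ^ n) ∣[n * k] γ = fun τ => f τ ^ n := by
  funext τ
  have h' := congrFun h τ
  rw [ModularForm.SL_slash_apply] at h' ⊢
  conv_rhs => rw [← h']
  rw [mul_pow, ← zpow_natCast (denom γ τ ^ (-k)), ← zpow_mul]
  congr 2
  ring

lemma HasQSeries.pow_of_zero {a : ℕ → ℂ} {f : ℍ → ℂ} (hf : HasQSeries 0 a f) (n : ℕ) :
    ∃ b, b 0 = a 0 ^ n ∧ HasQSeries 0 b fun τ => f τ ^ n := by
  induction n with
  | zero =>
    refine ⟨fun n => if n = 0 then 1 else 0, by simp, fun τ => ?_⟩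
    convert! hasSum_ite_eq (0 : ℕ) (1 : ℂ) using 2 with n
    split_ifs with h <;> simp [h]
  | succ n ih =>
    obtain ⟨b, hb, h⟩ := ih
    exact ⟨_, by simp [hb, pow_succ],
      (h.mul hf).of_eq (add_zero 0) (fun _ => rfl) fun τ => (pow_succ _ _).symm⟩

namespace SerrePoly

variable {x : ℍ → ℂ} {u w : Fin 2 → ℍ → ℂ}

lemma slash_evalMono {γ : SL(2, ℤ)} {M : Fin 2 → Fin 2 → ℂ}
    (hu : ∀ i, u i ∣[(5 : ℤ)] γ = fun τ => M i 0 * u 0 τ + M i 1 * u 1 τ)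
    (hw : ∀ i, w i ∣[(7 : ℤ)] γ = fun τ => M i 0 * w 0 τ + M i 1 * w 1 τ)
    (p : ℤ × ℕ × ℕ × Bool) (i : Fin 2) : evalMono (u i) (w i) p ∣[(weight p : ℤ)] γ =
      fun τ => M i 0 * evalMono (u 0) (w 0) p τ + M i 1 * evalMono (u 1) (w 1) p τ := by
  obtain ⟨c, a, b, e⟩ := p
  have hv : (fun τ => if e then 60 * w i τ else u i τ) ∣[((if e then 7 else 5 : ℕ) : ℤ)] γ =
      fun τ => M i 0 * (if e then 60 * w 0 τ else u 0 τ) +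
        M i 1 * (if e then 60 * w 1 τ else u 1 τ) := by
    cases e
    · simpa using! hu i
    · simp only [if_true]
      have := smul_slash_fun 7 γ (w i) 60
      rw [hw] at this
      rw [show ((7 : ℕ) : ℤ) = 7 from rfl, this]
      funext τ
      ring
  have h := smul_slash_fun (a * 4 + b * 6 + (if e then 7 else 5 : ℕ)) γ
    (fun τ => (eis4 τ ^ a * eis6 τ ^ b) * if e then 60 * w i τ else u i τ) c
  rw [mul_slash_fun _ _ γ (fun τ => eis4 τ ^ a * eis6 τ ^ b), mul_slash_fun _ _ γ (fun τ => eis4 τ ^ a),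
    hv, pow_slash_of_slash (slash_eis4 γ), pow_slash_of_slash (slash_eis6 γ)] at h
  have hk : (weight (c, a, b, e) : ℤ) = a * 4 + b * 6 + (if e then 7 else 5 : ℕ) := by
    simp only [weight]
    push_cast
    ring
  rw [hk]
  refine h.trans (funext fun τ => ?_)
  simp only [evalMono]
  ring

lemma slash_eval {γ : SL(2, ℤ)} {M : Fin 2 → Fin 2 → ℂ} {ε : ℂ} {m k : ℤ}
    (hu : ∀ i, u i ∣[(5 : ℤ)] γ = fun τ => M i 0 * u 0 τ + M i 1 * u 1 τ)
    (hw : ∀ i, w i ∣[(7 : ℤ)] γ = fun τ => M i 0 * w 0 τ + M i 1 * w 1 τ)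
    (hx : x ∣[-6 * m] γ = fun τ => ε * x τ) {l : SerrePoly}
    (hl : ∀ p ∈ l, (weight p : ℤ) = k + 6 * m) (i : Fin 2) :
    eval x (u i) (w i) l ∣[k] γ = fun τ => ε * M i 0 * eval x (u 0) (w 0) l τ +
      ε * M i 1 * eval x (u 1) (w 1) l τ := by
  induction l with
  | nil =>
    have : eval x (u i) (w i) [] = 0 := funext fun τ => eval_nil τ
    rw [this, SlashAction.zero_slash]
    funext τ
    simp [eval_nil]
  | cons p l ih =>
    have e : eval x (u i) (w i) (p :: l) =
        fun τ => x τ * evalMono (u i) (w i) p τ + eval x (u i) (w i) l τ := funext (eval_cons p l)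
    have hk : k = -6 * m + weight p := by rw [hl p List.mem_cons_self]; ring
    rw [e, add_slash_fun, ih fun q hq => hl q (List.mem_cons_of_mem _ hq)]
    funext τ
    conv_lhs => rw [hk, mul_slash_fun, hx, slash_evalMono hu hw]
    simp only [eval_cons]
    ring

/-- The leading coefficient of a combination, for `u` with exponent `2/5` or `3/5`. -/
def leading (j : Fin 2) (l : SerrePoly) : ℤ :=
  (l.map fun p => p.1 * if p.2.2.2 then (if j = 0 then -1 else 11) else 1).sum

lemma exists_hasQSeries_eval {j : Fin 2} {a b : ℕ → ℂ} {β : ℚ} {u w : ℍ → ℂ}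
    (hu : HasQSeries (kzExponent j) a u) (h : IsSerrePair u w) (hx : HasQSeries β b x)
    (hb : b 0 = 1) (l : SerrePoly) :
    ∃ c, c 0 = a 0 * leading j l ∧ HasQSeries (β + kzExponent j) c (eval x u w l) := by
  have hw : ∃ c, c 0 = a 0 * ((if j = 0 then -1 else 11 : ℤ) : ℂ) ∧
      HasQSeries (kzExponent j) c fun τ => 60 * w τ := by
    refine ⟨_, ?_, ((hu.deriv.sub (((hasQSeries_eis2.mul hu).of_eq (zero_add _) (fun _ => rfl)
      (fun _ => rfl)).const_mul (5 / 12))).const_mul 60).of_eq rfl (fun _ => rfl) fun τ => ?_⟩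
    · fin_cases j <;> simp [eisCoeff_zero, kzExponent] <;> ring
    · rw [h.left.deriv]
      ring
  obtain ⟨c', hc', hw⟩ := hw
  have hmono : ∀ p, ∃ c, c 0 = a 0 * ((p.1 * if p.2.2.2 then (if j = 0 then -1 else 11) else 1 : ℤ) : ℂ) ∧
      HasQSeries (kzExponent j) c (evalMono u w p) := by
    rintro ⟨n, y, z, e⟩
    obtain ⟨b₄, hb₄, h₄⟩ := hasQSeries_eis4.pow_of_zero y
    obtain ⟨b₆, hb₆, h₆⟩ := hasQSeries_eis6.pow_of_zero z
    rw [eisCoeff_zero, Int.cast_one, one_pow] at hb₄ hb₆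
    cases e
    · exact ⟨_, by simp [hb₄, hb₆, mul_comm], (((h₄.mul h₆).mul hu).const_mul n).of_eq
        (by simp) (fun _ => rfl) fun τ => by simp [evalMono]⟩
    · exact ⟨_, by simp [hb₄, hb₆, hc']; ring_nf, (((h₄.mul h₆).mul hw).const_mul n).of_eq
        (by simp) (fun _ => rfl) fun τ => by simp [evalMono]⟩
  induction l with
  | nil =>
    refine ⟨fun _ => 0, by simp [leading], fun τ => ?_⟩
    simp [eval_nil]
  | cons p l ih =>
    obtain ⟨c₁, hc₁, h₁⟩ := hmono p
    obtain ⟨c₂, hc₂, h₂⟩ := ih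
    refine ⟨_, ?_, ((hx.mul h₁).add h₂).of_eq rfl (fun _ => rfl) fun τ => (eval_cons p l τ).symm⟩
    simp only [antidiag_zero, hb, hc₁, hc₂, leading, List.map_cons, List.sum_cons]
    push_cast
    ring

/-- The conditions under which `E₂ A + B` is a multiple of the solution with exponent `X / 60`. -/
def IsQuasiDatum (r X : ℤ) (m N : ℕ) (j : Fin 2) (A B : SerrePoly) : Prop :=
  IsQuasiSolution r m A B ∧ leading 1 A ≠ 0 ∧ (N ≠ 0 → leading j A + leading j B = 0) ∧
  X = (if j = 0 then 24 else 36) - 30 * m + 60 * N ∧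
  (∀ n < N, n ≠ 0 → ∀ z ∈ [r + 15, 45 - r, r + 3, -r - 3], X - 60 * N + 60 * n ≠ z) ∧
  ∀ z ∈ [r + 15, 45 - r, r + 3, -r - 3], z < X + 60

instance (r X : ℤ) (m N : ℕ) (j : Fin 2) (A B : SerrePoly) : Decidable (IsQuasiDatum r X m N j A B) :=
  inferInstanceAs (Decidable (_ ∧ _))

-- Explicit `A` and `B` for the six exceptional pairs. Since `s = 2 r / 5` and `α = X / 60`, the
-- pair `(15 s, 360 α)` is `(6 r, 6 X)`.
set_option maxRecDepth 10000 in
lemma exists_isQuasiDatum : ∀ p ∈ quasiParams, ∃ r X m N j A B, p = (6 * r, 6 * X) ∧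
    IsQuasiDatum r X m N j A B := by
  intro p hp
  simp only [quasiParams, List.mem_cons, List.not_mem_nil, or_false] at hp
  rcases hp with rfl | rfl | rfl | rfl | rfl | rfl
  · exact ⟨-9, 6, 1, 0, 1, [(1, 0, 0, false)], [(1, 0, 0, true)], by decide +kernel⟩
  · exact ⟨21, 24, 2, 1, 0, [(-1, 0, 1, false), (-1, 1, 0, true)],
      [(1, 2, 0, false), (1, 0, 1, true)], by decide +kernel⟩
  · exact ⟨-39, 36, 2, 1, 1, [(5, 0, 1, false), (-7, 1, 0, true)],
      [(-5, 2, 0, false), (7, 0, 1, true)], by decide +kernel⟩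
  · exact ⟨-69, 66, 3, 2, 1, [(55, 0, 2, false), (77, 3, 0, false), (-156, 1, 1, true)],
      [(-132, 2, 1, false), (91, 0, 2, true), (65, 3, 0, true)], by decide +kernel⟩
  · exact ⟨-99, 96, 4, 3, 1,
      [(935, 0, 3, false), (3961, 3, 1, false), (-4009, 1, 2, true), (-1463, 4, 0, true)],
      [(-3791, 2, 2, false), (-1105, 5, 0, false), (1729, 0, 3, true), (3743, 3, 1, true)],
      by decide +kernel⟩
  · exact ⟨-159, 156, 6, 5, 1,
      [(623645, 0, 5, false), (8900390, 3, 3, false), (4908221, 6, 1, false),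
        (-4498255, 1, 4, true), (-9886210, 4, 2, true), (-1043119, 7, 0, true)],
      [(-4935365, 2, 4, false), (-8695766, 5, 2, false), (-801125, 8, 0, false),
        (1339975, 0, 5, true), (9774610, 3, 3, true), (4312999, 6, 1, true)],
      by decide +kernel⟩

end SerrePoly

/-! ### Identification of the given solution with the explicit one -/

lemma opCoeff_zero_ne {r X : ℤ} (h : ∀ z ∈ [r + 15, 45 - r, r + 3, -r - 3], X ≠ z) :
    opCoeff (2 * r / 5) 0 (X / 60) ≠ 0 := by
  simp only [List.mem_cons, List.not_mem_nil, or_false, forall_eq_or_imp, forall_eq] at h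
  obtain ⟨h1, h2, h3, h4⟩ := h
  have e : opCoeff (2 * r / 5) 0 (X / 60) =
      (((X - (r + 15)) * (X - (45 - r)) * (X - (r + 3)) * (X - (-r - 3)) : ℤ) : ℂ) / 60 ^ 4 := by
    rw [opCoeff_zero]
    push_cast
    ring
  rw [e]
  refine div_ne_zero (Int.cast_ne_zero.mpr ?_) (by norm_num)
  simp only [ne_eq, mul_eq_zero, sub_eq_zero, not_or]
  exact ⟨⟨⟨h1, h2⟩, h3⟩, h4⟩

/-- A solution of a regular-singular recurrence is determined by its leading coefficient. -/
lemma eq_mul_of_recurrence {P : ℕ → ℂ → ℂ} {β : ℂ} {a b : ℕ → ℂ} (ha0 : a 0 = 1)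
    (ha : ∀ n, ∑ p ∈ Finset.HasAntidiagonal.antidiagonal n, P p.1 (β + p.2) * a p.2 = 0)
    (hb : ∀ n, ∑ p ∈ Finset.HasAntidiagonal.antidiagonal n, P p.1 (β + p.2) * b p.2 = 0)
    (hP : ∀ n : ℕ, n ≠ 0 → P 0 (β + n) ≠ 0) (n : ℕ) : b n = b 0 * a n := by
  induction n using Nat.strong_induction_on with | _ n ih =>
  rcases n with _ | n
  · rw [ha0, mul_one]
  · have h : ∑ p ∈ Finset.HasAntidiagonal.antidiagonal (n + 1),
        P p.1 (β + p.2) * (b p.2 - b 0 * a p.2) = 0 := by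
      have : ∀ p : ℕ × ℕ, P p.1 (β + p.2) * (b p.2 - b 0 * a p.2) =
          P p.1 (β + p.2) * b p.2 - b 0 * (P p.1 (β + p.2) * a p.2) := fun p => by ring
      simp only [this, Finset.sum_sub_distrib, ← Finset.mul_sum, ha, hb, mul_zero, sub_zero]
    rw [Finset.Nat.sum_antidiagonal_succ, Finset.sum_eq_zero, add_zero] at h
    · exact sub_eq_zero.mp ((mul_eq_zero.mp h).resolve_left (hP _ (Nat.succ_ne_zero n)))
    · intro p hp
      have := Finset.HasAntidiagonal.mem_antidiagonal.mp hp
      rw [ih p.2 (by omega), sub_self, mul_zero]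

/-- Leading coefficients below a non-root of the indicial polynomial vanish. -/
lemma eq_zero_of_recurrence {P : ℕ → ℂ → ℂ} {β : ℂ} {b : ℕ → ℂ}
    (hb : ∀ n, ∑ p ∈ Finset.HasAntidiagonal.antidiagonal n, P p.1 (β + p.2) * b p.2 = 0) {N : ℕ}
    (h0 : N ≠ 0 → b 0 = 0) (hP : ∀ n < N, n ≠ 0 → P 0 (β + n) ≠ 0) (n : ℕ) (hn : n < N) :
    b n = 0 := by
  induction n using Nat.strong_induction_on with | _ n ih =>
  rcases n with _ | n
  · exact h0 (by omega)
  · have h := hb (n + 1)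
    rw [Finset.Nat.sum_antidiagonal_succ, Finset.sum_eq_zero, add_zero] at h
    · exact (mul_eq_zero.mp h).resolve_left (hP _ hn (Nat.succ_ne_zero n))
    · intro p hp
      have := Finset.HasAntidiagonal.mem_antidiagonal.mp hp
      rw [ih p.2 (by omega) (by omega), mul_zero]

/-- Functions transforming among two `q`-series are meromorphic at the cusps. -/
lemma isWeaklyHolomorphicModularForm_of_slash {k : ℤ} {F : Fin 2 → ℍ → ℂ} {β : Fin 2 → ℚ}
    {b : Fin 2 → ℕ → ℂ} (hF : ∀ i, HasQSeries (β i) (b i) (F i)) {Γ : Subgroup SL(2, ℤ)}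
    {M : SL(2, ℤ) → Fin 2 → Fin 2 → ℂ}
    (hM : ∀ γ i, F i ∣[k] γ = fun τ => M γ i 0 * F 0 τ + M γ i 1 * F 1 τ)
    (hΓ : ∀ γ ∈ Γ, ∀ i j, M γ i j = if i = j then 1 else 0) (i : Fin 2) :
    IsWeaklyHolomorphicModularForm Γ k (F i) where
  holo := (hF i).mdiff
  slash_eq γ hγ := by
    rw [hM, hΓ γ hγ, hΓ γ hγ]
    fin_cases i <;> simp
  meromorphic_cusps γ := by
    refine ⟨max (-(2 * Real.pi * β 0)) (-(2 * Real.pi * β 1)), ?_⟩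
    rw [hM]
    have h : ∀ c C : ℝ, c ≤ C → (fun τ : ℍ => Real.exp (c * τ.im)) =O[atImInfty]
        fun τ : ℍ => Real.exp (C * τ.im) := fun c C hc =>
      Asymptotics.isBigO_of_le _ fun τ => by
        rw [Real.norm_of_nonneg (Real.exp_nonneg _), Real.norm_of_nonneg (Real.exp_nonneg _)]
        exact Real.exp_le_exp.mpr (mul_le_mul_of_nonneg_right hc τ.im_pos.le)
    exact (((hF 0).isBigO.trans (h _ _ (le_max_left _ _))).const_mul_left _).add
      (((hF 1).isBigO.trans (h _ _ (le_max_right _ _))).const_mul_left _)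

lemma isWeaklyHolomorphicModularForm_const_mul {Γ : Subgroup SL(2, ℤ)} {k : ℤ} {F : ℍ → ℂ}
    (h : IsWeaklyHolomorphicModularForm Γ k F) (c : ℂ) :
    IsWeaklyHolomorphicModularForm Γ k fun τ => c * F τ where
  holo := mdifferentiable_const.mul h.holo
  slash_eq γ hγ := by rw [smul_slash_fun, h.slash_eq γ hγ]
  meromorphic_cusps γ := by
    obtain ⟨C, hC⟩ := h.meromorphic_cusps γ
    refine ⟨C, ?_⟩
    rw [smul_slash_fun]
    exact hC.const_mul_left c

/-- If `E₂ A + B = 0` with `A`, `B` modular on a group with a non-triangular element, then `A = 0`. -/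
lemma eq_zero_of_eis2_mul_add {Γ : Subgroup SL(2, ℤ)} {A B : ℍ → ℂ} {γ : SL(2, ℤ)} (hγ : γ ∈ Γ)
    (hc : γ 1 0 ≠ 0) (hA : IsWeaklyHolomorphicModularForm Γ (-1) A)
    (hB : IsWeaklyHolomorphicModularForm Γ 1 B) (h : ∀ τ, eis2 τ * A τ + B τ = 0) (τ : ℍ) :
    A τ = 0 := by
  have h1 : (fun τ => eis2 τ * A τ + B τ) ∣[(1 : ℤ)] γ = 0 := by
    rw [show (fun τ => eis2 τ * A τ + B τ) = 0 from funext h, SlashAction.zero_slash]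
  have e := mul_slash_fun 2 (-1) γ eis2 A
  norm_num only at e
  rw [add_slash_fun, e, hA.slash_eq γ hγ, hB.slash_eq γ hγ] at h1
  have h2 := congrFun h1 τ
  simp only [Pi.zero_apply, slash_eis2] at h2
  have h3 : 12 * (2 * Real.pi * Complex.I)⁻¹ * ((γ 1 0 : ℂ) / denom γ τ) * A τ = 0 := by
    linear_combination h2 - h τ
  refine (mul_eq_zero.mp h3).resolve_left (mul_ne_zero (mul_ne_zero (by norm_num)
    (inv_ne_zero Complex.two_pi_I_ne_zero)) (div_ne_zero ?_ (denom_ne_zero γ τ)))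
  exact_mod_cast hc

lemma mem_Gamma_of_dvd {M N : ℕ} (h : M ∣ N) {γ : SL(2, ℤ)} (hγ : γ ∈ CongruenceSubgroup.Gamma N) :
    γ ∈ CongruenceSubgroup.Gamma M := by
  rw [CongruenceSubgroup.Gamma_mem] at hγ ⊢
  have key : ∀ {x y : ℤ}, (x : ZMod N) = y → (x : ZMod M) = y := fun hxy => by
    simpa only [map_intCast] using congrArg (ZMod.castHom h (ZMod M)) hxy
  obtain ⟨h1, h2, h3, h4⟩ := hγ
  exact ⟨by simpa using key (y := 1) (by simpa using h1), by simpa using key (y := 0) (by simpa using h2),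
    by simpa using key (y := 0) (by simpa using h3), by simpa using key (y := 1) (by simpa using h4)⟩

lemma hasD_eta12_inv (m : ℕ) : HasD (fun τ => (eta12 τ ^ m)⁻¹)
    fun τ => -(m : ℂ) / 2 * eis2 τ * (eta12 τ ^ m)⁻¹ := by
  refine (hasD_inv (hasD_eta12.pow m) fun τ => pow_ne_zero _ (eta12_ne_zero τ)).congr
    (fun _ => rfl) fun τ => ?_
  have := eta12_ne_zero τ
  rcases m with _ | m
  · simp
  · rw [Nat.add_sub_cancel]
    field_simp
    ring

-- The series of `g = E₂ A + B` starts at exponent `α - N`, but its first `N` coefficients vanish: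
-- the leading one by the datum, the others because they do not sit at exponents of the equation.
-- Then `g` and `f` have the same leading exponent and no larger exponent interferes, so they are
-- proportional.
open SerrePoly in
lemma isQuasimodularOfPositiveDepth_of_isQuasiDatum {r X : ℤ} {m N : ℕ} {j : Fin 2}
    {lA lB : SerrePoly} (hd : IsQuasiDatum r X m N j lA lB) {f : ℍ → ℂ}
    (hsol : IsSolution (2 * r / 5) f) {a : ℕ → ℂ} (ha : a 0 = 1) (hf : HasQSeries (X / 60) a f) :
    IsQuasimodularOfPositiveDepth f := by
  obtain ⟨hq, hlead, hlead0, hX, hlow, hhigh⟩ := hd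
  obtain ⟨c, u, w, huw, hslash⟩ := exists_basis_slash
  obtain ⟨b, hb, hx⟩ := exists_hasQSeries_eta12_inv m
  set x : ℍ → ℂ := fun τ => (eta12 τ ^ m)⁻¹ with hxdef
  choose ε hε0 hε1 hxs using exists_slash_eta12_inv m
  let A : Fin 2 → ℍ → ℂ := fun i => eval x (u i) (w i) lA
  let B : Fin 2 → ℍ → ℂ := fun i => eval x (u i) (w i) lB
  have hAq := fun i => exists_hasQSeries_eval (huw i).2.1 (huw i).2.2 hx hb lA
  have hBq := fun i => exists_hasQSeries_eval (huw i).2.1 (huw i).2.2 hx hb lB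
  choose cA hcA hAq using hAq
  choose cB hcB hBq using hBq
  have hA : ∀ γ i, A i ∣[(-1 : ℤ)] γ = fun τ => ε γ * weilMatrix γ i 0 * A 0 τ +
      ε γ * weilMatrix γ i 1 * A 1 τ := fun γ i =>
    slash_eval (fun i => (hslash γ i).1) (fun i => (hslash γ i).2) (hxs γ) (fun p hp => by
      have := hq.1.1 0 (by norm_num) p hp
      push_cast [← @Nat.cast_inj ℤ] at this
      linarith) i
  have hB : ∀ γ i, B i ∣[(1 : ℤ)] γ = fun τ => ε γ * weilMatrix γ i 0 * B 0 τ +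
      ε γ * weilMatrix γ i 1 * B 1 τ := fun γ i =>
    slash_eval (fun i => (hslash γ i).1) (fun i => (hslash γ i).2) (hxs γ) (fun p hp => by
      have := hq.1.2 0 (by norm_num) p hp
      push_cast [← @Nat.cast_inj ℤ] at this
      linarith) i
  have hΓ : ∀ γ ∈ CongruenceSubgroup.Gamma 10, ∀ i k, ε γ * weilMatrix γ i k =
      if i = k then 1 else 0 := by
    intro γ hγ i k
    have h2 : γ ∈ CongruenceSubgroup.Gamma 2 := mem_Gamma_of_dvd (by norm_num) hγ
    have h5 : γ ∈ CongruenceSubgroup.Gamma 5 := mem_Gamma_of_dvd (by norm_num) hγ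
    rw [hε1 γ h2, weilMatrix_eq_one h5, one_mul]
  have mA := isWeaklyHolomorphicModularForm_of_slash hAq hA hΓ
  have mB := isWeaklyHolomorphicModularForm_of_slash hBq hB hΓ
  -- the leading coefficient of `A 1` does not vanish
  have hA1 : A 1 ≠ 0 := by
    intro h
    have h0 : HasQSeries (-m / 2 + kzExponent 1) (cA 1) 0 := h ▸ hAq 1
    have := h0.eq_zero 0
    rw [hcA, mul_eq_zero, Int.cast_eq_zero] at this
    exact this.elim (huw 1).1 hlead
  -- The leading coefficient of `A 0` may vanish, as it does in the datum with `j = 0`.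
  -- Non-vanishing is therefore taken from `A 1` and transported by `S`, whose off-diagonal entry is
  -- non-zero.
  have hAj : A j ≠ 0 := by
    intro h
    have h1 := hA ModularGroup.S j
    rw [h, SlashAction.zero_slash] at h1
    apply hA1
    fin_cases j
    · funext τ
      have h2 := congrFun h1 τ
      have h3 : A 0 τ = 0 := congrFun h τ
      simp only [Pi.zero_apply, Fin.zero_eta, h3, mul_zero, zero_add] at h2
      refine (mul_eq_zero.mp h2.symm).resolve_left (mul_ne_zero (hε0 _) ?_)
      rw [weilMatrix_S_values.2.1]
      refine mul_ne_zero (inv_ne_zero eval_gaussSum5_ne_zero) fun h4 => zeta5_ne_one ?_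
      have h5 := zeta5_pow
      linear_combination -(zeta5 ^ 3 + 1) * zeta5 ^ 4 * h4 +
        ((zeta5 ^ 3 + 1) * (1 - zeta5 ^ 3) - zeta5) * h5
    · exact h
  have hg := hq.isSolution (huw j).2.2 (hasD_eta12_inv m)
  set g : ℍ → ℂ := fun τ => eis2 τ * A j τ + B j τ with hgdef
  obtain ⟨d, hd0, hgq⟩ : ∃ d, d 0 = c j 0 * ((leading j lA + leading j lB : ℤ) : ℂ) ∧
      HasQSeries (-m / 2 + kzExponent j) d g := by
    refine ⟨_, ?_, (((hasQSeries_eis2.mul (hAq j)).of_eq (zero_add _) (fun _ => rfl)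
      (fun _ => rfl)).add (hBq j))⟩
    simp only [antidiag_zero, eisCoeff_zero, hcA, hcB]
    push_cast
    ring
  -- In units of 1/60, the exponents `2/5`, `3/5` are 24 and 36, and `η^(-12m)` contributes `-30 m`.
  have hβ : -(m : ℚ) / 2 + kzExponent j = (X - 60 * N) / 60 := by
    rw [hX, kzExponent]
    split_ifs <;> push_cast <;> ring
  have hzero := eq_zero_of_recurrence (hg.recurrence hgq) (N := N)
    (fun hN => by rw [hd0, hlead0 hN, Int.cast_zero, mul_zero]) fun n hn hn0 => by
      have := opCoeff_zero_ne (hlow n hn hn0)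
      rw [hβ]
      convert! this using 2
      push_cast
      ring
  have hgs := (hgq.shift N hzero).of_eq (β' := X / 60) (by rw [hβ]; ring) (fun _ => rfl)
    fun _ => rfl
  have hcoeff := eq_mul_of_recurrence ha (hsol.recurrence hf) (hg.recurrence hgs) fun n hn => by
    have := opCoeff_zero_ne (r := r) (X := X + 60 * n) fun z hz => by
      have := hhigh z hz
      omega
    convert! this using 2
    push_cast
    ring
  simp only [zero_add] at hcoeff
  have hgf : ∀ τ, g τ = d N * f τ := fun τ => by
    have := (hgs.sub (hf.const_mul (d N))).eq_zero_of_coeff fun n => by rw [hcoeff, sub_self]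
    exact sub_eq_zero.mp (congrFun this τ)
  -- Otherwise `E₂ A + B = 0`. Slashing by an element of `Γ(10)` with non-zero lower left entry
  -- would leave the non-modular part of `E₂` times `A`, forcing `A = 0`.
  have hdN : d N ≠ 0 := by
    intro h
    let γ : SL(2, ℤ) := ⟨!![1, 0; 10, 1], by simp⟩
    have hγ : γ ∈ CongruenceSubgroup.Gamma 10 := by
      rw [CongruenceSubgroup.Gamma_mem]
      decide
    exact hAj (funext (eq_zero_of_eis2_mul_add hγ (by decide) (mA j) (mB j) fun τ => by
      simpa [h] using hgf τ))
  refine ⟨CongruenceSubgroup.Gamma 10, 1, 1,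
    ⟨10, by norm_num, le_rfl⟩, one_pos,
    fun i τ => (d N)⁻¹ * if i = 0 then B j τ else A j τ, fun i hi => ?_, fun h => hAj ?_, fun τ => ?_⟩
  · refine isWeaklyHolomorphicModularForm_const_mul ?_ _
    interval_cases i
    · exact mB j
    · exact mA j
  · funext τ
    simpa [hdN] using congrFun h τ
  · have := hgf τ
    simp only [hgdef] at this
    simp only [Finset.sum_range_succ, Finset.range_zero, Finset.sum_empty]
    simp
    field_simp
    linear_combination -this

end MLDE

end

theorem mainTheorem4 (s : ℂ) (f : UpperHalfPlane → ℂ)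
    (hsol : MLDE.IsSolution s f)
    (hcft : MLDE.IsCFTType f)
    (hquasi : ¬ MLDE.IsQuasimodularOfPositiveDepth f) :
    s ∈ ({-48 / 5, -38 / 5, -6 / 5, -3 / 5, 2 / 5, 6 / 5, 12 / 5, 18 / 5, 22 / 5, 27 / 5, 6,
      32 / 5, 54 / 5, 18, -66 / 5, -6, -8 / 5} : Set ℂ) := by
  obtain ⟨α, a, ha, hf⟩ := hcft
  have hf' : MLDE.HasQSeries α (fun n => (a n : ℂ)) f := hf
  rcases MLDE.isListed_of_isSolution hsol ha hf' with ⟨t, ht, rfl⟩ | ⟨p, hp, rfl, rfl⟩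
  · simp only [MLDE.goodParams, List.mem_cons, List.not_mem_nil, or_false] at ht
    simp only [Set.mem_insert_iff, Set.mem_singleton_iff]
    rcases ht with rfl | rfl | rfl | rfl | rfl | rfl | rfl | rfl | rfl | rfl | rfl | rfl | rfl |
      rfl | rfl | rfl | rfl <;> norm_num
  · obtain ⟨r, X, m, N, j, A, B, rfl, hd⟩ := MLDE.SerrePoly.exists_isQuasiDatum p hp
    refine absurd (MLDE.isQuasimodularOfPositiveDepth_of_isQuasiDatum hd ?_ (a := fun n => (a n : ℂ))
      (by simp [ha]) (hf'.of_eq ?_ (fun _ => rfl) fun _ => rfl)) hquasi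
    · convert! hsol using 1
      push_cast
      ring
    · push_cast
      ring
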